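/- Consider the stochastic contextual bandit with linear payoffs. There are $N\ge 1$ arms and an unknown $\mu\in\mathbb R^d$. In each round $t=1,2,\dots$ context vectors $b_1(t),\dots,b_N(t)\in\mathbb R^d$ are revealed, chosen by an adversary that may adapt to the history $\mathcal H_{t-1}$ (the arms played, the rewards of the arms played, and all contexts in rounds $1,\dots,t-1$). The learner plays an arm $a(t)$ and observes its reward $r_{a(t)}(t)$. The rewards $r_i(t)$ satisfy $\mathbb E[r_i(t)\mid \mathcal H_{t-1},b_1(t),\dots,b_N(t)]=b_i(t)^T\mu$, and for a constant $R>0$ the noise $\eta_{i,t}=r_i(t)-b_i(t)^T\mu$ is conditionally $R$-sub-Gaussian: $\mathbb E[e^{\lambda\eta_{i,t}}\mid \mathcal H_{t-1},b_1(t),\dots,b_N(t)]\le e^{\lambda^2R^2/2}$ for all $\lambda\in\mathbb R$. Write $\Delta_i(t)=\max_j b_j(t)^T\mu-b_i(t)^T\mu$, assume $\|b_i(t)\|_2\le 1$, $\|\mu\|_2\le 1$ and $\Delta_i(t)\le 1$ for all $i,t$, and let $\mathcal R(T)=\sum_{t=1}^T\Delta_{a(t)}(t)$ be the total regret. Thompson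 Sampling with parameter $\delta\in(0,1)$ works as follows. In round $t$ put $B(t)=I_d+\sum_{\tau=1}^{t-1}b_{a(\tau)}(\tau)b_{a(\tau)}(\tau)^T$ and $\hat\mu(t)=B(t)^{-1}\sum_{\tau=1}^{t-1}b_{a(\tau)}(\tau)r_{a(\tau)}(\tau)$. Given $\mathcal H_{t-1}$ and the contexts of round $t$, draw $\tilde\mu(t)$ from $\mathcal N(\hat\mu(t),v_t^2B(t)^{-1})$ and play an arm $a(t)$ that maximizes $b_i(t)^T\tilde\mu(t)$ over $i$, ties being broken arbitrarily, where $\tilde\mu(t)$ and $a(t)$ are conditionally independent of the rewards $(r_i(t))_i$ of round $t$ given $\mathcal H_{t-1}$ and the contexts of round $t$. Here either $v_t=R\sqrt{9d\ln(t/\delta)}$ for all $t$ (horizon unknown), or $v_t=R\sqrt{9d\ln(T/\delta)}$ for all $t$ (horizon $T$ known). Then for every $R>0$ there is a constant $C$ depending only on $R$ such that for all $d$, $N\ge1$, $T\ge 2$, $0<\delta<1$, every such bandit problem and either choice of $v_t$, with probability at least $1-\delta$, $$\mathcal R(T)\le C\,\min\bigl\{d^{3/2}\sqrt T,\; d\sqrt{T\ln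 N}\bigr\}\left(\ln T+\sqrt{\ln T\,\ln(1/\delta)}\right).$$ -/

import Mathlib

open MeasureTheory ProbabilityTheory

noncomputable section

namespace LinBandit

/-- Context and parameter space `ℝ^d` with the Euclidean norm. -/
abbrev Vec (d : ℕ) : Type := EuclideanSpace ℝ (Fin d)

/-!
Throughout, rounds are `t = 1, 2, …` (index `0` is never used), arms are the elements of `Fin N`, and

* `b t i ω : Vec d` is the context of arm `i` in round `t`,
* `r t i ω : ℝ` is the reward of arm `i` in round `t`,
* `a t ω : Fin N` is the arm played in round `t`,
* `s t ω : Vec d` is the parameter vector sampled by the algorithm in round `t`.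
-/

section Processes

variable {Ω : Type*} {d N : ℕ}

/-- The gap `Δ_i(t)`: best mean reward in round `t` minus the mean reward of arm `i`. -/
def gap (μ : Vec d) (b : ℕ → Fin N → Ω → Vec d) (t : ℕ) (i : Fin N) (ω : Ω) : ℝ :=
  (⨆ j, inner ℝ (b t j ω) μ) - inner ℝ (b t i ω) μ

/-- The total regret `∑_{t=1}^T Δ_{a(t)}(t)`. -/
def regret (μ : Vec d) (b : ℕ → Fin N → Ω → Vec d) (a : ℕ → Ω → Fin N) (T : ℕ) (ω : Ω) : ℝ :=
  ∑ t ∈ Finset.Icc 1 T, gap μ b t (a t ω) ω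

/-- The σ-algebra of the history before round `t`: arms played, rewards of the arms played, and
all contexts, in rounds `1, …, t - 1`. -/
def history (b : ℕ → Fin N → Ω → Vec d) (r : ℕ → Fin N → Ω → ℝ) (a : ℕ → Ω → Fin N) (t : ℕ) :
    MeasurableSpace Ω :=
  ⨆ τ ∈ Finset.Ico 1 t,
    MeasurableSpace.comap (a τ) inferInstance ⊔
    MeasurableSpace.comap (fun ω => r τ (a τ ω) ω) inferInstance ⊔
    ⨆ i, MeasurableSpace.comap (b τ i) inferInstance

/-- The history before round `t` together with the contexts of round `t`. -/
def info (b : ℕ → Fin N → Ω → Vec d) (r : ℕ → Fin N → Ω → ℝ) (a : ℕ → Ω → Fin N) (t : ℕ) :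
    MeasurableSpace Ω :=
  history b r a t ⊔ ⨆ i, MeasurableSpace.comap (b t i) inferInstance

/-- `B(t) = I_d + ∑_{τ=1}^{t-1} b_{a(τ)}(τ) b_{a(τ)}(τ)ᵀ`. -/
def designMatrix (b : ℕ → Fin N → Ω → Vec d) (a : ℕ → Ω → Fin N) (t : ℕ) (ω : Ω) :
    Matrix (Fin d) (Fin d) ℝ :=
  1 + ∑ τ ∈ Finset.Ico 1 t,
    Matrix.vecMulVec (b τ (a τ ω) ω).ofLp (b τ (a τ ω) ω).ofLp

/-- `μ̂(t) = B(t)⁻¹ ∑_{τ=1}^{t-1} r_{a(τ)}(τ) b_{a(τ)}(τ)`. -/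
def estimate (b : ℕ → Fin N → Ω → Vec d) (r : ℕ → Fin N → Ω → ℝ) (a : ℕ → Ω → Fin N)
    (t : ℕ) (ω : Ω) : Vec d :=
  WithLp.toLp 2 (Matrix.mulVec (designMatrix b a t ω)⁻¹
    (∑ τ ∈ Finset.Ico 1 t, r τ (a τ ω) ω • (b τ (a τ ω) ω).ofLp))

/-- The stochastic contextual bandit with linear payoffs, parameter `μ` and conditionally
`R`-sub-Gaussian noise. The contexts are arbitrary random vectors, so they may be chosen by an
adaptive (and randomized) adversary. -/
structure IsLinearBandit [MeasurableSpace Ω] (P : Measure Ω) (R : ℝ) (μ : Vec d)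
    (b : ℕ → Fin N → Ω → Vec d) (r : ℕ → Fin N → Ω → ℝ) (a : ℕ → Ω → Fin N) : Prop where
  measurable_context : ∀ t, 1 ≤ t → ∀ i, Measurable (b t i)
  measurable_reward : ∀ t, 1 ≤ t → ∀ i, Measurable (r t i)
  measurable_arm : ∀ t, 1 ≤ t → Measurable (a t)
  norm_context_le : ∀ t, 1 ≤ t → ∀ i ω, ‖b t i ω‖ ≤ 1
  norm_param_le : ‖μ‖ ≤ 1
  gap_le : ∀ t, 1 ≤ t → ∀ i ω, gap μ b t i ω ≤ 1
  integrable_reward : ∀ t, 1 ≤ t → ∀ i, Integrable (r t i) P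
  /-- `E[r_i(t) | contexts of round t, history] = b_i(t)ᵀ μ`. -/
  mean_reward : ∀ t, 1 ≤ t → ∀ i,
    P[r t i | info b r a t] =ᵐ[P] fun ω => inner ℝ (b t i ω) μ
  integrable_exp_noise : ∀ t, 1 ≤ t → ∀ i, ∀ l : ℝ,
    Integrable (fun ω => Real.exp (l * (r t i ω - inner ℝ (b t i ω) μ))) P
  /-- `E[exp (l η_i(t)) | contexts of round t, history] ≤ exp (l² R² / 2)` for all real `l`. -/
  subGaussian_noise : ∀ t, 1 ≤ t → ∀ i, ∀ l : ℝ,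
    P[fun ω => Real.exp (l * (r t i ω - inner ℝ (b t i ω) μ)) | info b r a t]
      ≤ᵐ[P] fun _ => Real.exp (l ^ 2 * R ^ 2 / 2)

/-- The arms `a` are played by Thompson Sampling with scale parameters `v t`. -/
structure IsThompsonSampling [MeasurableSpace Ω] (P : Measure Ω) (v : ℕ → ℝ)
    (b : ℕ → Fin N → Ω → Vec d) (r : ℕ → Fin N → Ω → ℝ) (a : ℕ → Ω → Fin N)
    (s : ℕ → Ω → Vec d) : Prop where
  measurable_sample : ∀ t, 1 ≤ t → Measurable (s t)
  /-- Given the history and the contexts of round `t`, the sample has the Gaussian law with mean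
  `μ̂(t)` and covariance matrix `v_t² B(t)⁻¹`. -/
  sample_law : ∀ t, 1 ≤ t → ∀ A : Set (Vec d), MeasurableSet A →
    P⟦s t ⁻¹' A | info b r a t⟧ =ᵐ[P] fun ω =>
      (multivariateGaussian (estimate b r a t ω)
        ((v t) ^ 2 • (designMatrix b a t ω)⁻¹)).real A
  /-- The arm played maximizes `b_i(t)ᵀ s(t)`; ties may be broken arbitrarily. -/
  arm_argmax : ∀ t, 1 ≤ t → ∀ ω i, inner ℝ (b t i ω) (s t ω) ≤ inner ℝ (b t (a t ω) ω) (s t ω)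
  /-- The algorithm does not see the rewards of round `t` before it plays: its sample and its
  choice of arm (hence also its tie-breaking) are conditionally independent of the rewards of
  round `t`, given the history and the contexts of round `t`. -/
  choice_condIndep : ∀ t, 1 ≤ t → ∀ (A : Set (Vec d × Fin N)) (S : Set (Fin N → ℝ)),
    MeasurableSet A → MeasurableSet S →
    P⟦(fun ω => (s t ω, a t ω)) ⁻¹' A ∩ (fun ω i => r t i ω) ⁻¹' S | info b r a t⟧ =ᵐ[P]
      P⟦(fun ω => (s t ω, a t ω)) ⁻¹' A | info b r a t⟧ *
        P⟦(fun ω i => r t i ω) ⁻¹' S | info b r a t⟧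

end Processes

/-- `R √(9 d ln(x / δ))`: with `x = t` the scale of round `t` when the horizon is unknown, with
`x = T` the fixed scale for a known horizon `T`. -/
def scale (R : ℝ) (d : ℕ) (δ x : ℝ) : ℝ := R * √(9 * d * Real.log (x / δ))

/-- `d^{3/2} √T (ln T + √(ln T ln(1/δ)))`. -/
def dimBound (d T : ℕ) (δ : ℝ) : ℝ :=
  (d : ℝ) ^ (3 / 2 : ℝ) * √(T : ℝ) *
    (Real.log T + √(Real.log T * Real.log (1 / δ)))

/-- `d √(T ln N) (ln T + √(ln T ln(1/δ)))`. -/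
def armBound (d N T : ℕ) (δ : ℝ) : ℝ :=
  (d : ℝ) * √((T : ℝ) * Real.log N) *
    (Real.log T + √(Real.log T * Real.log (1 / δ)))

end LinBandit

end

/-! Let m = min(d, ln N), V = `scale R d δ T`, and g = K √m V with K depending only on R. Let w_t be
the width of the arm played in round t. The regret is controlled by three exponential
supermartingales and one deterministic inequality.

Noise. With S_t the noise-weighted sum of played contexts, exp(S_tᵀB(t)⁻¹S_t / 2R²) / √det B(t) is a
supermartingale (`condMeanLEOne_exp_selfNormIncrement`): each step is a one-dimensional Gaussian
mixture of the sub-Gaussian exponentials. Markov's inequality and det B(t) ≤ t^d put μ in the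
ellipsoid of radius κ v_t around the estimate in every round t ≥ 2 (`confident`).

Gap. Call an arm unsaturated if its gap is at most g times its width, and let X_t be the least value
of min((g·width)², 1) over these arms. Comparing the played arm with the minimizing unsaturated arm
gives gap ≤ (2g + Y_t)(√X_t / g + w_t), where Y_t is at most v_t times the largest standardized
deviation of the sample in the directions of the contexts (`gap_le_of_argmax`, `gap_le_excess_mul`).

Deviation. The squared largest deviation, divided by 4, has exponential moment at most exp(3m/2), by
the Euclidean norm of a Gaussian vector or by a sum over the arms (`lintegral_exp_maxDevSq_le`).
Hence ∑ Y_t² is of order V²(mT + ln(1/δ)). No bound on the deviation that is uniform over rounds is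
used, which saves a logarithm.

Exploration. Given the past, with probability at least a constant q depending only on R, the sample
is optimistic and deviates by O(√m) standard deviations. Then the arm played is unsaturated, so X_t
≤ min((g w_t)², 1). Therefore exp(∑ (q X_t / 2 - min((g w_t)², 1))) is a supermartingale on the
confident event (`condMeanLEOne_exp_explorationIncrement`), and ∑ X_t ≲ g² ∑ w_t² + ln(1/δ).

By the elliptical potential lemma ∑ w_t² ≲ d ln T. Cauchy–Schwarz over the rounds gives regret ≲ √(m
V² T) √(d ln T), and V² = 9R² d ln(T/δ) turns this into the claim (`regret_le_of_good`,
`regret_bound_le`). -/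

noncomputable section

namespace LinBandit

/-! ### Linear algebra of rank-one updates -/

section RankOne

open Matrix

variable {n : Type*} [Fintype n]

/-- Cauchy–Schwarz for the bilinear form of a positive semidefinite matrix. -/
lemma sq_dotProduct_mulVec_le [DecidableEq n] {A : Matrix n n ℝ} (hA : A.PosSemidef) (x y : n → ℝ) :
    (x ⬝ᵥ A *ᵥ y) ^ 2 ≤ (x ⬝ᵥ A *ᵥ x) * (y ⬝ᵥ A *ᵥ y) := by
  have h := (Matrix.toBilin' A).apply_sq_le_of_symm
    (fun z => by simpa [Matrix.toBilin'_apply'] using hA.dotProduct_mulVec_nonneg z)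
    (by
      refine ⟨fun u w => ?_⟩
      simp only [Matrix.toBilin'_apply', RingHom.id_apply]
      rw [dotProduct_mulVec, dotProduct_comm, ← mulVec_transpose]
      have : Aᵀ = A := by simpa using hA.isHermitian.eq
      rw [this]) x y
  simpa [Matrix.toBilin'_apply'] using h

lemma dotProduct_mulVec_comm_of_isHermitian {A : Matrix n n ℝ} (hA : A.IsHermitian)
    (x y : n → ℝ) : x ⬝ᵥ A *ᵥ y = y ⬝ᵥ A *ᵥ x := by
  rw [dotProduct_mulVec, dotProduct_comm, ← mulVec_transpose]
  have : Aᵀ = A := by simpa using hA.eq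
  rw [this]

lemma vecMulVec_mulVec_eq (u w x : n → ℝ) : vecMulVec u w *ᵥ x = (w ⬝ᵥ x) • u := by
  ext i
  simp [vecMulVec_mulVec, mul_comm]

/-- The matrix determinant lemma; it drives both the elliptical potential and the normalization of
the noise supermartingale. -/
lemma det_add_vecMulVec_self [DecidableEq n] {B : Matrix n n ℝ} (hB : B.PosDef) (u : n → ℝ) :
    (B + vecMulVec u u).det = B.det * (1 + u ⬝ᵥ B⁻¹ *ᵥ u) := by
  rw [vecMulVec_eq Unit, det_add_replicateCol_mul_replicateRow
    ((Matrix.isUnit_iff_isUnit_det _).mp hB.isUnit)]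
  congr 1
  rw [det_unique, Matrix.mul_assoc, ← replicateCol_mulVec, Matrix.add_apply, one_apply_eq,
    replicateRow_mul_replicateCol_apply]

lemma posDef_add_vecMulVec_self {B : Matrix n n ℝ} (hB : B.PosDef) (u : n → ℝ) :
    (B + vecMulVec u u).PosDef :=
  hB.add_posSemidef (by simpa using posSemidef_vecMulVec_self_star u)

/-- The effect of a rank-one update on the quadratic form of the inverse matrix. -/
lemma dotProduct_inv_add_vecMulVec_self [DecidableEq n] {B : Matrix n n ℝ} (hB : B.PosDef) (u y : n → ℝ) :
    y ⬝ᵥ (B + vecMulVec u u)⁻¹ *ᵥ y =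
      y ⬝ᵥ B⁻¹ *ᵥ y - (u ⬝ᵥ B⁻¹ *ᵥ y) ^ 2 / (1 + u ⬝ᵥ B⁻¹ *ᵥ u) := by
  have hBi := hB.inv
  set w := u ⬝ᵥ B⁻¹ *ᵥ u with hw
  have hw0 : 0 ≤ w := by simpa using hBi.posSemidef.dotProduct_mulVec_nonneg u
  set x := u ⬝ᵥ B⁻¹ *ᵥ y with hx
  have hunit : IsUnit B.det := (Matrix.isUnit_iff_isUnit_det _).mp hB.isUnit
  have hunit' : IsUnit (B + vecMulVec u u).det :=
    (Matrix.isUnit_iff_isUnit_det _).mp (posDef_add_vecMulVec_self hB u).isUnit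
  -- The Sherman–Morrison formula applied to `y`, checked by multiplying back.
  have key : (B + vecMulVec u u)⁻¹ *ᵥ y = B⁻¹ *ᵥ y - (x / (1 + w)) • (B⁻¹ *ᵥ u) := by
    have h1 : (B + vecMulVec u u) *ᵥ (B⁻¹ *ᵥ y - (x / (1 + w)) • (B⁻¹ *ᵥ u)) = y := by
      rw [mulVec_sub, mulVec_smul, add_mulVec, add_mulVec, mulVec_mulVec _ B, mulVec_mulVec _ B,
        mul_nonsing_inv _ hunit, one_mulVec, one_mulVec, vecMulVec_mulVec_eq, vecMulVec_mulVec_eq,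
        ← hw, ← hx]
      ext i
      simp only [Pi.add_apply, Pi.sub_apply, Pi.smul_apply, smul_eq_mul]
      field_simp
      ring
    conv_lhs => rw [← h1]
    rw [mulVec_mulVec, nonsing_inv_mul _ hunit', one_mulVec]
  rw [key, dotProduct_sub, dotProduct_smul, smul_eq_mul,
    dotProduct_mulVec_comm_of_isHermitian hBi.isHermitian y u, ← hx]
  ring

/-- The self-normalized quadratic form after one more observation `u` with noise `e`. -/
lemma dotProduct_inv_add_vecMulVec_self_add_smul [DecidableEq n] {B : Matrix n n ℝ} (hB : B.PosDef)
    (u y : n → ℝ) (e : ℝ) :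
    (y + e • u) ⬝ᵥ (B + vecMulVec u u)⁻¹ *ᵥ (y + e • u) =
      y ⬝ᵥ B⁻¹ *ᵥ y + (2 * e * (u ⬝ᵥ B⁻¹ *ᵥ y) + e ^ 2 * (u ⬝ᵥ B⁻¹ *ᵥ u)
        - (u ⬝ᵥ B⁻¹ *ᵥ y) ^ 2) / (1 + u ⬝ᵥ B⁻¹ *ᵥ u) := by
  have hBi := hB.inv
  have hw0 : 0 ≤ u ⬝ᵥ B⁻¹ *ᵥ u := by simpa using hBi.posSemidef.dotProduct_mulVec_nonneg u
  rw [dotProduct_inv_add_vecMulVec_self hB]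
  simp only [mulVec_add, mulVec_smul, dotProduct_add, add_dotProduct, dotProduct_smul,
    smul_dotProduct, smul_eq_mul]
  rw [dotProduct_mulVec_comm_of_isHermitian hBi.isHermitian y u]
  have : 1 + u ⬝ᵥ B⁻¹ *ᵥ u ≠ 0 := by positivity
  field_simp
  ring

/-- Each eigenvalue is the quadratic form at a unit eigenvector, hence at most `c`. -/
lemma det_le_pow_of_forall_dotProduct_le [DecidableEq n] {B : Matrix n n ℝ} (hB : B.PosDef) {c : ℝ}
    (h : ∀ x : n → ℝ, x ⬝ᵥ B *ᵥ x ≤ c * (x ⬝ᵥ x)) : B.det ≤ c ^ Fintype.card n := by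
  rw [hB.isHermitian.det_eq_prod_eigenvalues]
  simp only [RCLike.ofReal_real_eq_id, id]
  rw [← Finset.card_univ, ← Finset.prod_const]
  refine Finset.prod_le_prod (fun i _ => hB.posSemidef.eigenvalues_nonneg i) (fun i _ => ?_)
  have h1 := h (hB.isHermitian.eigenvectorBasis i).ofLp
  have h2 : (hB.isHermitian.eigenvectorBasis i).ofLp ⬝ᵥ
      (hB.isHermitian.eigenvectorBasis i).ofLp = 1 := by
    have := (hB.isHermitian.eigenvectorBasis).orthonormal.1 i
    rw [EuclideanSpace.norm_eq, Real.sqrt_eq_one] at this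
    simpa [dotProduct, sq] using this
  rw [hB.isHermitian.mulVec_eigenvectorBasis i] at h1
  simpa [dotProduct_smul, h2] using h1

/-- With z = B⁻¹y the hypothesis reads z·z ≤ z·y; insert this into 0 ≤ |y - z|². -/
lemma dotProduct_inv_le_dotProduct_self [DecidableEq n] {B : Matrix n n ℝ} (hB : B.PosDef)
    (h : ∀ x : n → ℝ, x ⬝ᵥ x ≤ x ⬝ᵥ B *ᵥ x) (y : n → ℝ) : y ⬝ᵥ B⁻¹ *ᵥ y ≤ y ⬝ᵥ y := by
  have hunit : IsUnit B.det := (Matrix.isUnit_iff_isUnit_det _).mp hB.isUnit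
  set z := B⁻¹ *ᵥ y with hz
  have hy : B *ᵥ z = y := by rw [hz, mulVec_mulVec, mul_nonsing_inv _ hunit, one_mulVec]
  have h1 := h z
  rw [hy] at h1
  have h2 : 0 ≤ (y - z) ⬝ᵥ (y - z) := by simpa using dotProduct_star_self_nonneg (y - z)
  simp only [dotProduct_sub, sub_dotProduct] at h2
  rw [dotProduct_comm z y] at h1 h2
  linarith

end RankOne

/-! ### The design matrix, widths and the self-normalized noise -/

section Design

open Matrix

variable {Ω : Type*} {d N : ℕ}

/-- The width `√(b_i(t)ᵀ B(t)⁻¹ b_i(t))` of the confidence interval of arm `i` in round `t`. -/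
def width (b : ℕ → Fin N → Ω → Vec d) (a : ℕ → Ω → Fin N) (t : ℕ) (i : Fin N) (ω : Ω) : ℝ :=
  √((b t i ω).ofLp ⬝ᵥ (designMatrix b a t ω)⁻¹ *ᵥ (b t i ω).ofLp)

/-- The noise-weighted sum of the contexts played before round `t`. -/
def noiseSum (μ : Vec d) (b : ℕ → Fin N → Ω → Vec d) (r : ℕ → Fin N → Ω → ℝ) (a : ℕ → Ω → Fin N)
    (t : ℕ) (ω : Ω) : Fin d → ℝ :=
  ∑ τ ∈ Finset.Ico 1 t,
    (r τ (a τ ω) ω - inner ℝ (b τ (a τ ω) ω) μ) • (b τ (a τ ω) ω).ofLp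

/-- The squared norm of `noiseSum` with respect to the inverse of the design matrix. -/
def selfNormSq (μ : Vec d) (b : ℕ → Fin N → Ω → Vec d) (r : ℕ → Fin N → Ω → ℝ)
    (a : ℕ → Ω → Fin N) (t : ℕ) (ω : Ω) : ℝ :=
  noiseSum μ b r a t ω ⬝ᵥ (designMatrix b a t ω)⁻¹ *ᵥ noiseSum μ b r a t ω

variable {μ : Vec d} {b : ℕ → Fin N → Ω → Vec d} {r : ℕ → Fin N → Ω → ℝ} {a : ℕ → Ω → Fin N}

lemma dotProduct_ofLp_eq_inner (x y : Vec d) : x.ofLp ⬝ᵥ y.ofLp = inner ℝ x y := by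
  simp [PiLp.inner_apply, dotProduct, mul_comm]

lemma dotProduct_ofLp_self (x : Vec d) : x.ofLp ⬝ᵥ x.ofLp = ‖x‖ ^ 2 := by
  rw [dotProduct_ofLp_eq_inner, real_inner_self_eq_norm_sq]

lemma designMatrix_one (ω : Ω) : designMatrix b a 1 ω = 1 := by
  simp [designMatrix]

lemma designMatrix_succ {t : ℕ} (ht : 1 ≤ t) (ω : Ω) :
    designMatrix b a (t + 1) ω = designMatrix b a t ω +
      vecMulVec (b t (a t ω) ω).ofLp (b t (a t ω) ω).ofLp := by
  simp only [designMatrix, Finset.sum_Ico_succ_top ht, add_assoc]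

lemma noiseSum_one (ω : Ω) : noiseSum μ b r a 1 ω = 0 := by
  simp [noiseSum]

lemma noiseSum_succ {t : ℕ} (ht : 1 ≤ t) (ω : Ω) :
    noiseSum μ b r a (t + 1) ω = noiseSum μ b r a t ω +
      (r t (a t ω) ω - inner ℝ (b t (a t ω) ω) μ) • (b t (a t ω) ω).ofLp := by
  simp only [noiseSum, Finset.sum_Ico_succ_top ht]

lemma posDef_designMatrix (t : ℕ) (ω : Ω) : (designMatrix b a t ω).PosDef := by
  refine Matrix.PosDef.one.add_posSemidef (posSemidef_sum _ fun τ _ => ?_)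
  simpa using posSemidef_vecMulVec_self_star (b τ (a τ ω) ω).ofLp

lemma posDef_designMatrix_inv (t : ℕ) (ω : Ω) : (designMatrix b a t ω)⁻¹.PosDef :=
  (posDef_designMatrix t ω).inv

lemma dotProduct_inv_designMatrix_nonneg (t : ℕ) (ω : Ω) (x : Fin d → ℝ) :
    0 ≤ x ⬝ᵥ (designMatrix b a t ω)⁻¹ *ᵥ x := by
  simpa using (posDef_designMatrix_inv t ω).posSemidef.dotProduct_mulVec_nonneg x

lemma dotProduct_designMatrix (t : ℕ) (ω : Ω) (x : Fin d → ℝ) :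
    x ⬝ᵥ designMatrix b a t ω *ᵥ x =
      x ⬝ᵥ x + ∑ τ ∈ Finset.Ico 1 t, ((b τ (a τ ω) ω).ofLp ⬝ᵥ x) ^ 2 := by
  rw [designMatrix, add_mulVec, one_mulVec, dotProduct_add, sum_mulVec, dotProduct_sum]
  congr 1
  refine Finset.sum_congr rfl fun τ _ => ?_
  rw [vecMulVec_mulVec_eq, dotProduct_smul, smul_eq_mul, dotProduct_comm x, sq]

lemma dotProduct_self_le_designMatrix (t : ℕ) (ω : Ω) (x : Fin d → ℝ) :
    x ⬝ᵥ x ≤ x ⬝ᵥ designMatrix b a t ω *ᵥ x := by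
  rw [dotProduct_designMatrix]
  exact le_add_of_nonneg_right (Finset.sum_nonneg fun _ _ => sq_nonneg _)

lemma dotProduct_designMatrix_le (hb : ∀ t, 1 ≤ t → ∀ i ω, ‖b t i ω‖ ≤ 1) {t : ℕ} (ht : 1 ≤ t)
    (ω : Ω) (x : Fin d → ℝ) :
    x ⬝ᵥ designMatrix b a t ω *ᵥ x ≤ t * (x ⬝ᵥ x) := by
  rw [dotProduct_designMatrix]
  have h : ∀ τ ∈ Finset.Ico 1 t, ((b τ (a τ ω) ω).ofLp ⬝ᵥ x) ^ 2 ≤ x ⬝ᵥ x := by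
    intro τ hτ
    have h1 := hb τ (Finset.mem_Ico.mp hτ).1 (a τ ω) ω
    have h2 := abs_real_inner_le_norm (b τ (a τ ω) ω) (WithLp.toLp 2 x)
    have h3 : x ⬝ᵥ x = ‖(WithLp.toLp 2 x : Vec d)‖ ^ 2 := dotProduct_ofLp_self (WithLp.toLp 2 x)
    have h4 : (b τ (a τ ω) ω).ofLp ⬝ᵥ x = inner ℝ (b τ (a τ ω) ω) (WithLp.toLp 2 x) :=
      dotProduct_ofLp_eq_inner _ (WithLp.toLp 2 x)
    rw [h3, h4]
    refine sq_le_sq.mpr ?_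
    rw [abs_norm]
    exact h2.trans (mul_le_of_le_one_left (norm_nonneg _) h1)
  have h1 := Finset.sum_le_card_nsmul _ _ _ h
  rw [Nat.card_Ico, nsmul_eq_mul, Nat.cast_sub ht, Nat.cast_one] at h1
  linarith

lemma one_le_det_designMatrix {t : ℕ} (ht : 1 ≤ t) (ω : Ω) : 1 ≤ (designMatrix b a t ω).det := by
  induction t, ht using Nat.le_induction with
  | base => simp [designMatrix_one]
  | succ t ht ih =>
    rw [designMatrix_succ ht, det_add_vecMulVec_self (posDef_designMatrix t ω)]
    have := dotProduct_inv_designMatrix_nonneg (a := a) (b := b) t ω (b t (a t ω) ω).ofLp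
    nlinarith

lemma det_designMatrix_le (hb : ∀ t, 1 ≤ t → ∀ i ω, ‖b t i ω‖ ≤ 1) {t : ℕ} (ht : 1 ≤ t) (ω : Ω) :
    (designMatrix b a t ω).det ≤ (t : ℝ) ^ d := by
  simpa using det_le_pow_of_forall_dotProduct_le (posDef_designMatrix t ω)
    (dotProduct_designMatrix_le hb ht ω)

lemma log_det_designMatrix_le (hb : ∀ t, 1 ≤ t → ∀ i ω, ‖b t i ω‖ ≤ 1) {t : ℕ} (ht : 1 ≤ t)
    (ω : Ω) : Real.log (designMatrix b a t ω).det ≤ d * Real.log t := by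
  rw [← Real.log_pow]
  exact Real.log_le_log (zero_lt_one.trans_le (one_le_det_designMatrix ht ω))
    (det_designMatrix_le hb ht ω)

lemma width_nonneg (t : ℕ) (i : Fin N) (ω : Ω) : 0 ≤ width b a t i ω := Real.sqrt_nonneg _

lemma sq_width (t : ℕ) (i : Fin N) (ω : Ω) :
    width b a t i ω ^ 2 = (b t i ω).ofLp ⬝ᵥ (designMatrix b a t ω)⁻¹ *ᵥ (b t i ω).ofLp :=
  Real.sq_sqrt (dotProduct_inv_designMatrix_nonneg t ω _)

lemma dotProduct_inv_designMatrix_le (t : ℕ) (ω : Ω) (x : Vec d) :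
    x.ofLp ⬝ᵥ (designMatrix b a t ω)⁻¹ *ᵥ x.ofLp ≤ ‖x‖ ^ 2 := by
  rw [← dotProduct_ofLp_self]
  exact dotProduct_inv_le_dotProduct_self (posDef_designMatrix t ω)
    (dotProduct_self_le_designMatrix t ω) _

lemma sq_width_le_one (hb : ∀ t, 1 ≤ t → ∀ i ω, ‖b t i ω‖ ≤ 1) {t : ℕ} (ht : 1 ≤ t)
    (i : Fin N) (ω : Ω) : width b a t i ω ^ 2 ≤ 1 := by
  rw [sq_width]
  refine (dotProduct_inv_designMatrix_le t ω _).trans ?_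
  exact pow_le_one₀ (norm_nonneg _) (hb t ht i ω)

/-- From log(1 + w) ≥ w / (1 + w) ≥ w / 2. -/
lemma le_two_mul_log_one_add {w : ℝ} (h0 : 0 ≤ w) (h1 : w ≤ 1) : w ≤ 2 * Real.log (1 + w) := by
  have h := Real.one_sub_inv_le_log_of_pos (show 0 < 1 + w by linarith)
  have h2 : w / 2 ≤ 1 - (1 + w)⁻¹ := by
    have : 1 - (1 + w)⁻¹ = w / (1 + w) := by field_simp; ring
    rw [this]
    gcongr
    linarith
  linarith

/-- The elliptical potential lemma. -/
lemma sum_sq_width_le (hb : ∀ t, 1 ≤ t → ∀ i ω, ‖b t i ω‖ ≤ 1) (T : ℕ) (ω : Ω) :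
    ∑ t ∈ Finset.Icc 1 T, width b a t (a t ω) ω ^ 2 ≤
      2 * Real.log (designMatrix b a (T + 1) ω).det := by
  induction T with
  | zero => simp [designMatrix_one]
  | succ T ih =>
    rw [Finset.sum_Icc_succ_top (by omega), designMatrix_succ (by omega),
      det_add_vecMulVec_self (posDef_designMatrix _ ω), ← sq_width, Real.log_mul
        (zero_lt_one.trans_le (one_le_det_designMatrix (by omega) ω)).ne'
        (by have := sq_nonneg (width b a (T + 1) (a (T + 1) ω) ω); positivity)]
    have := le_two_mul_log_one_add (sq_nonneg (width b a (T + 1) (a (T + 1) ω) ω))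
      (sq_width_le_one hb (by omega) _ ω)
    linarith

/-- The normal equations: the error splits into the noise and the bias `-μ` caused by the identity
matrix in the design. -/
lemma estimate_sub (t : ℕ) (ω : Ω) :
    (estimate b r a t ω - μ).ofLp =
      (designMatrix b a t ω)⁻¹ *ᵥ (noiseSum μ b r a t ω - μ.ofLp) := by
  have hunit : IsUnit (designMatrix b a t ω).det :=
    (Matrix.isUnit_iff_isUnit_det _).mp (posDef_designMatrix t ω).isUnit
  have h1 : ∑ τ ∈ Finset.Ico 1 t, r τ (a τ ω) ω • (b τ (a τ ω) ω).ofLp =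
      noiseSum μ b r a t ω - μ.ofLp + designMatrix b a t ω *ᵥ μ.ofLp := by
    rw [designMatrix, add_mulVec, one_mulVec, sum_mulVec, noiseSum]
    have : ∀ τ, vecMulVec (b τ (a τ ω) ω).ofLp (b τ (a τ ω) ω).ofLp *ᵥ μ.ofLp =
        (inner ℝ (b τ (a τ ω) ω) μ : ℝ) • (b τ (a τ ω) ω).ofLp := fun τ => by
      rw [vecMulVec_mulVec_eq, dotProduct_ofLp_eq_inner]
    simp only [this, sub_smul, Finset.sum_sub_distrib]
    abel
  rw [estimate, h1, WithLp.ofLp_sub, mulVec_add, mulVec_mulVec, nonsing_inv_mul _ hunit,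
    one_mulVec, add_sub_cancel_right]

/-- Cauchy–Schwarz for the inverse design matrix, applied to noise and bias separately; the bias
contributes at most ‖μ‖ because the design matrix dominates the identity. -/
lemma abs_inner_estimate_sub_le (hμ : ‖μ‖ ≤ 1) (t : ℕ) (i : Fin N) (ω : Ω) :
    |inner ℝ (b t i ω) (estimate b r a t ω) - inner ℝ (b t i ω) μ| ≤
      width b a t i ω * (√(selfNormSq μ b r a t ω) + 1) := by
  have hA := (posDef_designMatrix_inv (b := b) (a := a) t ω).posSemidef
  rw [← inner_sub_right, ← dotProduct_ofLp_eq_inner, estimate_sub (μ := μ), mulVec_sub,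
    dotProduct_sub, mul_add]
  refine (abs_sub _ _).trans (add_le_add ?_ ?_)
  · refine Real.abs_le_sqrt (sq_dotProduct_mulVec_le hA _ _) |>.trans_eq ?_
    rw [Real.sqrt_mul (dotProduct_inv_designMatrix_nonneg t ω _)]
    rfl
  · refine Real.abs_le_sqrt (sq_dotProduct_mulVec_le hA _ _) |>.trans ?_
    rw [Real.sqrt_mul (dotProduct_inv_designMatrix_nonneg t ω _)]
    refine mul_le_mul_of_nonneg_left ?_ (Real.sqrt_nonneg _)
    refine Real.sqrt_le_one.mpr ?_
    exact (dotProduct_inv_designMatrix_le t ω μ).trans (pow_le_one₀ (norm_nonneg _) hμ)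

lemma selfNormSq_succ {t : ℕ} (ht : 1 ≤ t) (ω : Ω) :
    selfNormSq μ b r a (t + 1) ω = selfNormSq μ b r a t ω +
      (2 * (r t (a t ω) ω - inner ℝ (b t (a t ω) ω) μ) * ((b t (a t ω) ω).ofLp ⬝ᵥ
          (designMatrix b a t ω)⁻¹ *ᵥ noiseSum μ b r a t ω) +
        (r t (a t ω) ω - inner ℝ (b t (a t ω) ω) μ) ^ 2 * width b a t (a t ω) ω ^ 2 -
        ((b t (a t ω) ω).ofLp ⬝ᵥ (designMatrix b a t ω)⁻¹ *ᵥ noiseSum μ b r a t ω) ^ 2) /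
      (1 + width b a t (a t ω) ω ^ 2) := by
  rw [selfNormSq, noiseSum_succ ht, designMatrix_succ ht, sq_width,
    dotProduct_inv_add_vecMulVec_self_add_smul (posDef_designMatrix t ω)]
  rfl

end Design

/-! ### Integration against conditional laws and conditional independence -/

section Conditioning

open scoped ENNReal

/-- A countable family of real half-lines, pulled back along a measurable embedding, identifies a
probability measure. -/
lemma ae_eq_of_forall_ae_apply_eq {α E : Type*} [MeasurableSpace α] {P : Measure α}
    [MeasurableSpace E] [StandardBorelSpace E] (κ ν : α → Measure E)
    [∀ x, IsProbabilityMeasure (κ x)] [∀ x, IsProbabilityMeasure (ν x)]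
    (h : ∀ A, MeasurableSet A → ∀ᵐ x ∂P, κ x A = ν x A) : ∀ᵐ x ∂P, κ x = ν x := by
  obtain ⟨f, hf⟩ := exists_measurableEmbedding_real E
  have h1 : ∀ᵐ x ∂P, ∀ q : ℚ, κ x (f ⁻¹' Set.Iic (q : ℝ)) = ν x (f ⁻¹' Set.Iic (q : ℝ)) :=
    ae_all_iff.mpr fun q => h _ (hf.measurable measurableSet_Iic)
  filter_upwards [h1] with x hx
  have h2 : (κ x).map f = (ν x).map f := by
    have := Measure.isProbabilityMeasure_map (μ := κ x) hf.measurable.aemeasurable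
    have := Measure.isProbabilityMeasure_map (μ := ν x) hf.measurable.aemeasurable
    refine ext_of_generate_finite _ (by
      rw [← Real.borel_eq_generateFrom_Iic_rat]; exact BorelSpace.measurable_eq)
      Real.isPiSystem_Iic_rat ?_ (by simp)
    intro s hs
    simp only [Set.mem_iUnion, Set.mem_singleton_iff] at hs
    obtain ⟨q, rfl⟩ := hs
    rw [Measure.map_apply hf.measurable measurableSet_Iic,
      Measure.map_apply hf.measurable measurableSet_Iic, hx q]
  ext A hA
  have h3 := congrArg (fun ρ : Measure ℝ => ρ (f '' A)) h2
  simpa [hf.map_apply, hf.injective.preimage_image] using h3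

/-- If `ν ω` is the conditional law of `Y` given `X` then the expectation of a function of `(X, Y)`
can be computed by integrating first over `ν ω`. -/
lemma lintegral_comp_eq_lintegral_condLaw {Ω β E : Type*} {mΩ : MeasurableSpace Ω}
    {mβ : MeasurableSpace β} {P : Measure Ω} [IsProbabilityMeasure P] [MeasurableSpace E]
    [StandardBorelSpace E] [Nonempty E] {X : Ω → β} (hX : Measurable X) {Y : Ω → E}
    (hY : Measurable Y) (ν : Ω → Measure E) [∀ ω, IsProbabilityMeasure (ν ω)]
    (hν : ∀ A, MeasurableSet A → P⟦Y ⁻¹' A | mβ.comap X⟧ =ᵐ[P] fun ω => (ν ω).real A)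
    {F : β × E → ℝ≥0∞} (hF : Measurable F) :
    ∫⁻ ω, F (X ω, Y ω) ∂P = ∫⁻ ω, ∫⁻ y, F (X ω, y) ∂(ν ω) ∂P := by
  have h1 : ∀ᵐ ω ∂P, condDistrib Y X P (X ω) = ν ω := by
    refine ae_eq_of_forall_ae_apply_eq _ _ fun A hA => ?_
    filter_upwards [condDistrib_ae_eq_condExp (μ := P) hX hY hA, hν A hA] with ω h1 h2
    rw [h2] at h1
    simpa [measureReal_def, ENNReal.toReal_eq_toReal_iff'] using h1
  calc ∫⁻ ω, F (X ω, Y ω) ∂P = ∫⁻ z, F z ∂(P.map fun ω => (X ω, Y ω)) :=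
        (lintegral_map hF (hX.prodMk hY)).symm
    _ = ∫⁻ x, ∫⁻ y, F (x, y) ∂(condDistrib Y X P x) ∂(P.map X) := by
        rw [← compProd_map_condDistrib hY.aemeasurable, Measure.lintegral_compProd hF]
    _ = ∫⁻ ω, ∫⁻ y, F (X ω, y) ∂(condDistrib Y X P (X ω)) ∂P :=
        lintegral_map hF.lintegral_kernel_prod_right' hX
    _ = ∫⁻ ω, ∫⁻ y, F (X ω, y) ∂(ν ω) ∂P := by
        refine lintegral_congr_ae ?_
        filter_upwards [h1] with ω hω
        rw [hω]

lemma setLIntegral_ofReal_eq_ofReal_setIntegral {Ω : Type*} {mΩ : MeasurableSpace Ω}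
    {P : Measure Ω} {g : Ω → ℝ} (hg : Integrable g P) (hg0 : 0 ≤ᵐ[P] g) (A : Set Ω) :
    ∫⁻ ω in A, ENNReal.ofReal (g ω) ∂P = ENNReal.ofReal (∫ ω in A, g ω ∂P) :=
  (ofReal_integral_eq_lintegral_ofReal hg.integrableOn (ae_restrict_of_ae hg0)).symm

/-- If `D` and `Y` are conditionally independent given `X`, then the event `D` can be replaced by
its conditional probability when a function of `(X, Y)` is integrated over it. -/
lemma setLIntegral_eq_lintegral_condProb {Ω β E : Type*} {m mΩ : MeasurableSpace Ω}
    {mβ : MeasurableSpace β} {P : Measure Ω} [IsProbabilityMeasure P] [MeasurableSpace E]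
    {X : Ω → β} (hX : Measurable X) (hmX : m = mβ.comap X) {Y : Ω → E} (hY : Measurable Y) {D : Set Ω}
    (hD : MeasurableSet D)
    (hind : ∀ S, MeasurableSet S → P⟦D ∩ Y ⁻¹' S | m⟧ =ᵐ[P]
      P⟦D | m⟧ * P⟦Y ⁻¹' S | m⟧)
    {F : β × E → ℝ≥0∞} (hF : Measurable F) :
    ∫⁻ ω in D, F (X ω, Y ω) ∂P =
      ∫⁻ ω, ENNReal.ofReal ((P⟦D | m⟧) ω) * F (X ω, Y ω) ∂P := by
  have hm : m ≤ mΩ := hmX ▸ hX.comap_le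
  have hφm : StronglyMeasurable[m] (P⟦D | m⟧) := stronglyMeasurable_condExp
  have hφmeas : Measurable (P⟦D | m⟧) := (hφm.mono hm).measurable
  have hφ0 : 0 ≤ᵐ[P] P⟦D | m⟧ := condExp_nonneg (ae_of_all _ fun ω =>
    Set.indicator_nonneg (fun _ _ => zero_le_one) ω)
  have hφint : Integrable (P⟦D | m⟧) P := integrable_condExp
  set ρ := P.withDensity fun ω => ENNReal.ofReal ((P⟦D | m⟧) ω) with hρ
  have : IsFiniteMeasure ρ := isFiniteMeasure_withDensity_ofReal hφint.2
  -- Two finite laws of (X, Y), one restricted to D and one weighted by the conditional probability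
  -- of D, agree once they agree on rectangles.
  have key : (P.restrict D).map (fun ω => (X ω, Y ω)) = ρ.map (fun ω => (X ω, Y ω)) := by
    refine Measure.ext_prod fun {s t} hs ht => ?_
    rw [Measure.map_apply (hX.prodMk hY) (hs.prod ht), Measure.map_apply (hX.prodMk hY)
      (hs.prod ht), Set.mk_preimage_prod, Measure.restrict_apply ((hX hs).inter (hY ht)),
      hρ, withDensity_apply _ ((hX hs).inter (hY ht))]
    have hA : MeasurableSet[m] (X ⁻¹' s) := hmX ▸ ⟨s, hs, rfl⟩
    have hYt := hY ht
    have hS : Integrable ((Y ⁻¹' t).indicator fun _ => (1 : ℝ)) P :=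
      (integrable_const _).indicator hYt
    have hprod : Integrable (P⟦D | m⟧ * (Y ⁻¹' t).indicator fun _ => (1 : ℝ)) P := by
      have : (P⟦D | m⟧ * (Y ⁻¹' t).indicator fun _ => (1 : ℝ)) =
          (Y ⁻¹' t).indicator (P⟦D | m⟧) := by
        ext ω; by_cases h : ω ∈ Y ⁻¹' t <;> simp [h]
      rw [this]
      exact hφint.indicator hYt
    have h1 : P (X ⁻¹' s ∩ Y ⁻¹' t ∩ D) =
        ENNReal.ofReal (∫ ω in X ⁻¹' s, (P⟦D ∩ Y ⁻¹' t | m⟧) ω ∂P) := by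
      rw [setIntegral_condExp hm ((integrable_const _).indicator (hD.inter hYt)) hA,
        setIntegral_indicator (hD.inter hYt), setIntegral_const, smul_eq_mul, mul_one,
        ofReal_measureReal]
      congr 1
      ext ω; simp only [Set.mem_inter_iff]; tauto
    have h2 : ∫ ω in X ⁻¹' s, (P⟦D ∩ Y ⁻¹' t | m⟧) ω ∂P =
        ∫ ω in X ⁻¹' s, (P⟦D | m⟧ * (Y ⁻¹' t).indicator fun _ => (1 : ℝ)) ω ∂P := by
      rw [← setIntegral_condExp hm hprod hA]
      refine setIntegral_congr_ae (hm _ hA) ?_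
      filter_upwards [hind t ht, condExp_mul_of_stronglyMeasurable_left hφm hprod hS]
        with ω h3 h4 _
      rw [h3, h4]
    rw [h1, h2, ← setLIntegral_ofReal_eq_ofReal_setIntegral hprod, ← lintegral_indicator
      (hm _ hA), ← lintegral_indicator ((hX hs).inter hYt)]
    · refine lintegral_congr fun ω => ?_
      by_cases h : ω ∈ X ⁻¹' s <;> by_cases h' : ω ∈ Y ⁻¹' t <;> simp [h, h', Set.indicator]
    · filter_upwards [hφ0] with ω h
      exact mul_nonneg h (Set.indicator_nonneg (fun _ _ => zero_le_one) ω)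
  calc ∫⁻ ω in D, F (X ω, Y ω) ∂P = ∫⁻ z, F z ∂((P.restrict D).map fun ω => (X ω, Y ω)) :=
        (lintegral_map hF (hX.prodMk hY)).symm
    _ = ∫⁻ ω, F (X ω, Y ω) ∂ρ := by rw [key, lintegral_map hF (hX.prodMk hY)]
    _ = _ := by
      rw [hρ]
      exact lintegral_withDensity_eq_lintegral_mul _ hφmeas.ennreal_ofReal
        (hF.comp (hX.prodMk hY))

/-- After trimming to `m`, the measure with density `g` is dominated by `K` times `P`. Working with
measures avoids any integrability requirement on `φ`. -/
lemma lintegral_mul_ofReal_le_of_condExp_le {Ω : Type*} {m mΩ : MeasurableSpace Ω}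
    {P : Measure Ω} [IsProbabilityMeasure P] (hm : m ≤ mΩ) {g : Ω → ℝ} (hg : Integrable g P)
    (hgm : Measurable g) (hg0 : 0 ≤ᵐ[P] g) {K : ℝ} (hK : P[g | m] ≤ᵐ[P] fun _ => K)
    {φ : Ω → ℝ≥0∞} (hφ : Measurable[m] φ) :
    ∫⁻ ω, φ ω * ENNReal.ofReal (g ω) ∂P ≤ ENNReal.ofReal K * ∫⁻ ω, φ ω ∂P := by
  have h1 : (P.withDensity fun ω => ENNReal.ofReal (g ω)).trim hm ≤
      ENNReal.ofReal K • P.trim hm := by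
    refine Measure.le_iff.mpr fun A hA => ?_
    rw [trim_measurableSet_eq hm hA, Measure.smul_apply, trim_measurableSet_eq hm hA,
      withDensity_apply _ (hm _ hA), setLIntegral_ofReal_eq_ofReal_setIntegral hg hg0,
      ← setIntegral_condExp hm hg hA, smul_eq_mul]
    have h2 : ∫ ω in A, (P[g | m]) ω ∂P ≤ K * P.real A := by
      refine (setIntegral_mono_ae integrable_condExp.integrableOn
        (integrable_const K).integrableOn hK).trans_eq ?_
      rw [setIntegral_const, smul_eq_mul, mul_comm]
    refine (ENNReal.ofReal_le_ofReal h2).trans ?_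
    rw [ENNReal.ofReal_mul' measureReal_nonneg, ofReal_measureReal]
  have h2 : ∫⁻ ω, φ ω * ENNReal.ofReal (g ω) ∂P =
      ∫⁻ ω, φ ω ∂(P.withDensity fun ω => ENNReal.ofReal (g ω)) := by
    rw [lintegral_withDensity_eq_lintegral_mul _ hgm.ennreal_ofReal (hφ.mono hm le_rfl)]
    simp [mul_comm]
  rw [h2, ← lintegral_trim hm hφ, ← lintegral_trim hm hφ]
  refine (lintegral_mono' h1 le_rfl).trans_eq ?_
  rw [lintegral_smul_measure, smul_eq_mul]

end Conditioning

/-! ### Products of factors with conditional mean at most one -/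

section Supermartingale

open scoped ENNReal

variable {Ω : Type*} {mΩ : MeasurableSpace Ω}

/-- The conditional expectation of `f` given `m` is at most one, phrased by integrals. -/
def CondMeanLEOne (P : Measure Ω) (m : MeasurableSpace Ω) (f : Ω → ℝ≥0∞) : Prop :=
  ∀ ψ : Ω → ℝ≥0∞, Measurable[m] ψ → ∫⁻ ω, ψ ω * f ω ∂P ≤ ∫⁻ ω, ψ ω ∂P

/-- Peel off the last factor, with the product of the earlier ones as the test function. -/
lemma lintegral_prod_le_one {P : Measure Ω} [IsProbabilityMeasure P]
    {𝓕 : ℕ → MeasurableSpace Ω} (hmono : Monotone 𝓕) {f : ℕ → Ω → ℝ≥0∞} {s T : ℕ}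
    (hf : ∀ t ∈ Finset.Ico s T, Measurable[𝓕 (t + 1)] (f t))
    (hc : ∀ t ∈ Finset.Ico s T, CondMeanLEOne P (𝓕 t) (f t)) :
    ∫⁻ ω, ∏ t ∈ Finset.Ico s T, f t ω ∂P ≤ 1 := by
  induction T with
  | zero => simp
  | succ T ih =>
    rcases Nat.lt_or_ge T s with h | h
    · simp [Finset.Ico_eq_empty_of_le (show T + 1 ≤ s by omega)]
    · have hsub : ∀ t ∈ Finset.Ico s T, t ∈ Finset.Ico s (T + 1) := fun t ht => by
        simp only [Finset.mem_Ico] at ht ⊢; omega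
      simp only [Finset.prod_Ico_succ_top h]
      refine (hc T (by simp [h]) _ ?_).trans
        (ih (fun t ht => hf t (hsub t ht)) fun t ht => hc t (hsub t ht))
      refine Finset.measurable_prod _ fun t ht => (hf t (hsub t ht)).mono (hmono ?_) le_rfl
      simp only [Finset.mem_Ico] at ht; omega

/-- A product of factors with conditional mean at most one exceeds `1 / ε` with probability at most
`ε`. -/
lemma measure_exp_sum_gt_le {P : Measure Ω} [IsProbabilityMeasure P]
    {𝓕 : ℕ → MeasurableSpace Ω} (hmono : Monotone 𝓕) (hle : ∀ t, 𝓕 t ≤ mΩ) {ξ : ℕ → Ω → ℝ}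
    {s T : ℕ} (hf : ∀ t ∈ Finset.Ico s T, Measurable[𝓕 (t + 1)] (ξ t))
    (hc : ∀ t ∈ Finset.Ico s T,
      CondMeanLEOne P (𝓕 t) (fun ω => ENNReal.ofReal (Real.exp (ξ t ω))))
    {ε : ℝ} (hε : 0 < ε) :
    P {ω | Real.log (1 / ε) < ∑ t ∈ Finset.Ico s T, ξ t ω} ≤ ENNReal.ofReal ε := by
  have h1 := lintegral_prod_le_one (P := P) hmono (f := fun t ω =>
    ENNReal.ofReal (Real.exp (ξ t ω))) (fun t ht => by
      exact (Real.measurable_exp.comp (hf t ht)).ennreal_ofReal) hc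
  have h2 : ∀ ω, ∏ t ∈ Finset.Ico s T, ENNReal.ofReal (Real.exp (ξ t ω)) =
      ENNReal.ofReal (Real.exp (∑ t ∈ Finset.Ico s T, ξ t ω)) := fun ω => by
    rw [Real.exp_sum, ENNReal.ofReal_prod_of_nonneg fun _ _ => (Real.exp_pos _).le]
  simp only [h2] at h1
  have h3 : Measurable fun ω => ENNReal.ofReal (Real.exp (∑ t ∈ Finset.Ico s T, ξ t ω)) := by
    refine (Real.measurable_exp.comp (Finset.measurable_sum _ fun t ht => ?_)).ennreal_ofReal
    exact (hf t ht).mono (hle _) le_rfl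
  have h4 := mul_meas_ge_le_lintegral₀ (μ := P) h3.aemeasurable (ENNReal.ofReal (1 / ε))
  have h5 : P {ω | Real.log (1 / ε) < ∑ t ∈ Finset.Ico s T, ξ t ω} ≤
      P {ω | ENNReal.ofReal (1 / ε) ≤
        ENNReal.ofReal (Real.exp (∑ t ∈ Finset.Ico s T, ξ t ω))} := by
    refine measure_mono fun ω hω => ?_
    refine ENNReal.ofReal_le_ofReal ?_
    rw [← Real.exp_log (show 0 < 1 / ε by positivity)]
    exact Real.exp_le_exp.mpr (le_of_lt hω)
  refine h5.trans ?_
  have h6 := h4.trans h1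
  have h7 : ENNReal.ofReal ε * ENNReal.ofReal (1 / ε) = 1 := by
    rw [← ENNReal.ofReal_mul hε.le, mul_one_div_cancel hε.ne', ENNReal.ofReal_one]
  calc _ = ENNReal.ofReal ε * (ENNReal.ofReal (1 / ε) * P _) := by rw [← mul_assoc, h7, one_mul]
    _ ≤ ENNReal.ofReal ε * 1 := by gcongr
    _ = _ := mul_one _

end Supermartingale

/-! ### One-dimensional Gaussian integrals -/

section Gaussian

open scoped ENNReal

/-- Completing the square turns the integrand into a multiple of the density of the Gaussian with
mean B/(1+c) and variance 1/(1+c). -/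
lemma lintegral_exp_quadratic_gaussianReal (B : ℝ) {c : ℝ} (hc : 0 < 1 + c) :
    ∫⁻ z, ENNReal.ofReal (Real.exp (B * z - c * z ^ 2 / 2)) ∂(gaussianReal 0 1) =
      ENNReal.ofReal ((√(1 + c))⁻¹ * Real.exp (B ^ 2 / (2 * (1 + c)))) := by
  set v : NNReal := ⟨(1 + c)⁻¹, by positivity⟩ with hv
  have hvc : (v : ℝ) = (1 + c)⁻¹ := rfl
  have hv0 : v ≠ 0 := by
    intro h
    have : (v : ℝ) = 0 := by rw [h]; rfl
    rw [hvc] at this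
    exact (inv_pos.mpr hc).ne' this
  rw [gaussianReal_of_var_ne_zero _ one_ne_zero, lintegral_withDensity_eq_lintegral_mul _
    (measurable_gaussianPDF 0 1) (by fun_prop)]
  have h : ∀ z : ℝ, (gaussianPDF 0 1 * fun z => ENNReal.ofReal (Real.exp (B * z - c * z ^ 2 / 2))) z
      = ENNReal.ofReal ((√(1 + c))⁻¹ * Real.exp (B ^ 2 / (2 * (1 + c)))) *
        gaussianPDF (B / (1 + c)) v z := by
    intro z
    rw [Pi.mul_apply, gaussianPDF, gaussianPDF, ← ENNReal.ofReal_mul (gaussianPDFReal_nonneg _ _ _),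
      ← ENNReal.ofReal_mul (by positivity)]
    congr 1
    rw [gaussianPDFReal, gaussianPDFReal, hvc, mul_assoc, ← Real.exp_add]
    rw [show (√(1 + c))⁻¹ * Real.exp (B ^ 2 / (2 * (1 + c))) *
      ((√(2 * Real.pi * (1 + c)⁻¹))⁻¹ *
        Real.exp (-(z - B / (1 + c)) ^ 2 / (2 * (1 + c)⁻¹))) =
      ((√(1 + c))⁻¹ * (√(2 * Real.pi * (1 + c)⁻¹))⁻¹) * (Real.exp (B ^ 2 / (2 * (1 + c))) *
        Real.exp (-(z - B / (1 + c)) ^ 2 / (2 * (1 + c)⁻¹))) by ring, ← Real.exp_add,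
      ← mul_inv, ← Real.sqrt_mul hc.le]
    have e1 : (1 + c) * (2 * Real.pi * (1 + c)⁻¹) = 2 * Real.pi * (1 : NNReal) := by
      rw [NNReal.coe_one]
      field_simp
    have e2 : B ^ 2 / (2 * (1 + c)) + -(z - B / (1 + c)) ^ 2 / (2 * (1 + c)⁻¹) =
        -(z - 0) ^ 2 / (2 * (1 : NNReal)) + (B * z - c * z ^ 2 / 2) := by
      rw [NNReal.coe_one]
      field_simp
      ring
    rw [e1, e2]
  rw [lintegral_congr h, lintegral_const_mul _ (measurable_gaussianPDF _ _),
    lintegral_gaussianPDF_eq_one _ hv0, mul_one]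

lemma lintegral_exp_sq_div_four_gaussianReal :
    ∫⁻ z, ENNReal.ofReal (Real.exp (z ^ 2 / 4)) ∂(gaussianReal 0 1) = ENNReal.ofReal (√2) := by
  have h := lintegral_exp_quadratic_gaussianReal 0 (c := -1 / 2) (by norm_num)
  have h1 : (√(1 + -1 / 2 : ℝ))⁻¹ = √2 := by
    rw [← Real.sqrt_inv]; norm_num
  rw [h1] at h
  convert h using 4
  · ring_nf
  · simp

end Gaussian

/-! ### Predictable exponents and the Gaussian mixture -/

section Noise

open scoped ENNReal

variable {Ω : Type*} {m mΩ : MeasurableSpace Ω}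

/-- A conditional sub-Gaussian bound for constant exponents extends to exponents that are known at
the time of conditioning. -/
lemma lintegral_exp_mul_sub_le_of_measurable (hm : m ≤ mΩ) {ν : Measure Ω}
    {η : Ω → ℝ} (hη : Measurable η) {R : ℝ}
    (h : ∀ (l : ℝ) (ψ : Ω → ℝ≥0∞), Measurable[m] ψ →
      ∫⁻ ω, ψ ω * ENNReal.ofReal (Real.exp (l * η ω)) ∂ν ≤
        ENNReal.ofReal (Real.exp (l ^ 2 * R ^ 2 / 2)) * ∫⁻ ω, ψ ω ∂ν)
    {Λ : Ω → ℝ} (hΛ : Measurable[m] Λ) {ψ : Ω → ℝ≥0∞} (hψ : Measurable[m] ψ) :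
    ∫⁻ ω, ψ ω * ENNReal.ofReal (Real.exp (Λ ω * η ω - Λ ω ^ 2 * R ^ 2 / 2)) ∂ν ≤
      ∫⁻ ω, ψ ω ∂ν := by
  have hψ' : Measurable ψ := hψ.mono hm le_rfl
  have hconst : ∀ (l : ℝ) (φ : Ω → ℝ≥0∞), Measurable[m] φ →
      ∫⁻ ω, φ ω * ENNReal.ofReal (Real.exp (l * η ω - l ^ 2 * R ^ 2 / 2)) ∂ν ≤
        ∫⁻ ω, φ ω ∂ν := by
    intro l φ hφ
    have hφ' : Measurable φ := hφ.mono hm le_rfl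
    have h1 : ∀ ω, φ ω * ENNReal.ofReal (Real.exp (l * η ω - l ^ 2 * R ^ 2 / 2)) =
        ENNReal.ofReal (Real.exp (-(l ^ 2 * R ^ 2 / 2))) *
          (φ ω * ENNReal.ofReal (Real.exp (l * η ω))) := by
      intro ω
      rw [sub_eq_neg_add, Real.exp_add, ENNReal.ofReal_mul (Real.exp_pos _).le]
      ring
    simp only [h1]
    rw [lintegral_const_mul _ (by fun_prop)]
    refine (mul_le_mul_right (h l φ hφ) _).trans_eq ?_
    rw [← mul_assoc, ← ENNReal.ofReal_mul (Real.exp_pos _).le, ← Real.exp_add,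
      neg_add_cancel, Real.exp_zero, ENNReal.ofReal_one, one_mul]
  -- For a simple exponent, sum the constant case over the level sets, which lie in `m`; Fatou's
  -- lemma then reaches a general exponent.
  have hsimple : ∀ f : @SimpleFunc Ω m ℝ,
      ∫⁻ ω, ψ ω * ENNReal.ofReal (Real.exp (f ω * η ω - f ω ^ 2 * R ^ 2 / 2)) ∂ν ≤
        ∫⁻ ω, ψ ω ∂ν := by
    intro f
    have hfib : ∀ l, MeasurableSet[m] (f ⁻¹' {l}) := fun l => @SimpleFunc.measurableSet_fiber _ _ m f l
    have hsum : ∀ φ : Ω → ℝ≥0∞, ∀ ω, φ ω =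
        ∑ l ∈ @SimpleFunc.range _ _ m f, (f ⁻¹' {l}).indicator φ ω := by
      intro φ ω
      rw [Finset.sum_eq_single (f ω)]
      · simp
      · intro l _ hl
        simp [Set.indicator, hl.symm]
      · intro hω
        exact absurd (@SimpleFunc.mem_range_self _ _ m f ω) hω
    rw [lintegral_congr (hsum ψ), lintegral_congr (hsum fun ω =>
      ψ ω * ENNReal.ofReal (Real.exp (f ω * η ω - f ω ^ 2 * R ^ 2 / 2)))]
    have hfm : Measurable (f : Ω → ℝ) := (@SimpleFunc.measurable _ _ m _ f).mono hm le_rfl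
    rw [lintegral_finsetSum _ fun l _ => hψ'.indicator (hm _ (hfib l)),
      lintegral_finsetSum _ fun l _ => Measurable.indicator (by fun_prop) (hm _ (hfib l))]
    refine Finset.sum_le_sum fun l _ => ?_
    refine le_trans (le_of_eq ?_) (hconst l _ (hψ.indicator (hfib l)))
    refine lintegral_congr fun ω => ?_
    by_cases hω : f ω = l <;> simp [Set.indicator, hω]
  have hΛs : StronglyMeasurable[m] Λ := hΛ.stronglyMeasurable
  set f := hΛs.approx
  have hlim : ∀ ω, Filter.Tendsto (fun n => ψ ω * ENNReal.ofReal
      (Real.exp (f n ω * η ω - f n ω ^ 2 * R ^ 2 / 2))) Filter.atTop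
      (nhds (ψ ω * ENNReal.ofReal (Real.exp (Λ ω * η ω - Λ ω ^ 2 * R ^ 2 / 2)))) := by
    intro ω
    have h1 := hΛs.tendsto_approx ω
    refine ENNReal.Tendsto.const_mul ?_ (Or.inl (by simp [Real.exp_pos]))
    refine ENNReal.tendsto_ofReal ((Real.continuous_exp.tendsto _).comp ?_)
    exact (h1.mul_const _).sub (((h1.pow 2).mul_const _).div_const _)
  have hfm : ∀ n, Measurable (f n : Ω → ℝ) := fun n =>
    (@SimpleFunc.measurable _ _ m _ (f n)).mono hm le_rfl
  calc _ = ∫⁻ ω, Filter.liminf (fun n => ψ ω * ENNReal.ofReal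
        (Real.exp (f n ω * η ω - f n ω ^ 2 * R ^ 2 / 2))) Filter.atTop ∂ν :=
        lintegral_congr fun ω => (hlim ω).liminf_eq.symm
    _ ≤ Filter.liminf (fun n => ∫⁻ ω, ψ ω * ENNReal.ofReal
        (Real.exp (f n ω * η ω - f n ω ^ 2 * R ^ 2 / 2)) ∂ν) Filter.atTop :=
        lintegral_liminf_le fun n => by have := hfm n; fun_prop
    _ ≤ _ := by
        refine Filter.liminf_le_of_le (by isBoundedDefault) fun c hc => ?_
        obtain ⟨n, hn⟩ := hc.exists
        exact hn.trans (hsimple (f n))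

/-- The Gaussian mixture of the exponential supermartingales of sub-Gaussian noise. -/
lemma lintegral_exp_mixture_le (hm : m ≤ mΩ) {ν : Measure Ω} [SFinite ν]
    {η : Ω → ℝ} (hη : Measurable η) {R : ℝ} (hR : 0 < R)
    (h : ∀ (l : ℝ) (ψ : Ω → ℝ≥0∞), Measurable[m] ψ →
      ∫⁻ ω, ψ ω * ENNReal.ofReal (Real.exp (l * η ω)) ∂ν ≤
        ENNReal.ofReal (Real.exp (l ^ 2 * R ^ 2 / 2)) * ∫⁻ ω, ψ ω ∂ν)
    {x w : Ω → ℝ} (hx : Measurable[m] x) (hw : Measurable[m] w) (hw0 : ∀ ω, 0 ≤ w ω)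
    {ψ : Ω → ℝ≥0∞} (hψ : Measurable[m] ψ) :
    ∫⁻ ω, ψ ω * ENNReal.ofReal ((√(1 + w ω))⁻¹ * Real.exp
      ((2 * η ω * x ω + η ω ^ 2 * w ω - x ω ^ 2) / (1 + w ω) / (2 * R ^ 2))) ∂ν ≤
      ∫⁻ ω, ψ ω ∂ν := by
  have hψ' : Measurable ψ := hψ.mono hm le_rfl
  have hx' : Measurable x := hx.mono hm le_rfl
  have hw' : Measurable w := hw.mono hm le_rfl
  -- The exponent is mixed over a Gaussian with mean x/R² and variance w/R². Since these parameters
  -- are known at the time of conditioning, each fixed `z` gives a predictable exponent.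
  have hmix : ∀ ω, ENNReal.ofReal ((√(1 + w ω))⁻¹ * Real.exp
      ((2 * η ω * x ω + η ω ^ 2 * w ω - x ω ^ 2) / (1 + w ω) / (2 * R ^ 2))) =
      ∫⁻ z, ENNReal.ofReal (Real.exp ((x ω + R * √(w ω) * z) / R ^ 2 * η ω -
        ((x ω + R * √(w ω) * z) / R ^ 2) ^ 2 * R ^ 2 / 2)) ∂(gaussianReal 0 1) := by
    intro ω
    have hpos : 0 < 1 + w ω := by linarith [hw0 ω]
    have hsq : √(w ω) ^ 2 = w ω := Real.sq_sqrt (hw0 ω)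
    have h1 : ∀ z, ENNReal.ofReal (Real.exp ((x ω + R * √(w ω) * z) / R ^ 2 * η ω -
        ((x ω + R * √(w ω) * z) / R ^ 2) ^ 2 * R ^ 2 / 2)) =
        ENNReal.ofReal (Real.exp ((2 * x ω * η ω - x ω ^ 2) / (2 * R ^ 2))) *
          ENNReal.ofReal (Real.exp (√(w ω) * (η ω - x ω) / R * z - w ω * z ^ 2 / 2)) := by
      intro z
      rw [← ENNReal.ofReal_mul (Real.exp_pos _).le, ← Real.exp_add]
      congr 2
      nth_rewrite 4 [← hsq]
      field_simp
      ring
    rw [lintegral_congr h1, lintegral_const_mul _ (by fun_prop),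
      lintegral_exp_quadratic_gaussianReal _ hpos, ← ENNReal.ofReal_mul (Real.exp_pos _).le]
    congr 1
    rw [mul_left_comm, ← Real.exp_add]
    congr 2
    rw [div_pow, mul_pow, hsq]
    field_simp
    ring
  calc _ = ∫⁻ ω, ∫⁻ z, ψ ω * ENNReal.ofReal (Real.exp ((x ω + R * √(w ω) * z) / R ^ 2 * η ω -
        ((x ω + R * √(w ω) * z) / R ^ 2) ^ 2 * R ^ 2 / 2)) ∂(gaussianReal 0 1) ∂ν := by
        refine lintegral_congr fun ω => ?_
        rw [hmix ω, lintegral_const_mul _ (by fun_prop)]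
    _ = ∫⁻ z, ∫⁻ ω, ψ ω * ENNReal.ofReal (Real.exp ((x ω + R * √(w ω) * z) / R ^ 2 * η ω -
        ((x ω + R * √(w ω) * z) / R ^ 2) ^ 2 * R ^ 2 / 2)) ∂ν ∂(gaussianReal 0 1) :=
        lintegral_lintegral_swap (by fun_prop)
    _ ≤ ∫⁻ _z, ∫⁻ ω, ψ ω ∂ν ∂(gaussianReal 0 1) := by
        refine lintegral_mono fun z => ?_
        refine lintegral_exp_mul_sub_le_of_measurable hm hη h ?_ hψ
        exact (hx.add ((hw.sqrt.const_mul R).mul_const z)).div_const _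
    _ = _ := by simp

end Noise

/-! ### Concentration and anti-concentration of Gaussian vectors -/

section MultivariateGaussian

open Matrix
open scoped ENNReal MatrixOrder

variable {d N : ℕ}

lemma map_inner_stdGaussian (c : Vec d) :
    (stdGaussian (Vec d)).map (fun z => inner ℝ c z) = gaussianReal 0 (‖c‖₊ ^ 2) := by
  have h := IsGaussian.map_eq_gaussianReal (μ := stdGaussian (Vec d)) (innerSL ℝ c)
  rw [integral_strongDual_stdGaussian, variance_dual_stdGaussian, innerSL_apply_norm] at h
  have h2 : (‖c‖ ^ 2).toNNReal = ‖c‖₊ ^ 2 := by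
    rw [Real.toNNReal_pow (norm_nonneg _), norm_toNNReal]
  rw [h2] at h
  exact h

lemma map_inner_stdGaussian_eq_map_mul (c : Vec d) :
    (stdGaussian (Vec d)).map (fun z => inner ℝ c z) = (gaussianReal 0 1).map (‖c‖ * ·) := by
  rw [map_inner_stdGaussian, gaussianReal_map_const_mul, mul_zero, mul_one]
  congr 1

lemma gaussianReal_Ici_pos (κ : ℝ) : 0 < (gaussianReal 0 1).real (Set.Ici κ) := by
  rw [measureReal_def, ENNReal.toReal_pos_iff]
  refine ⟨pos_iff_ne_zero.mpr fun h => ?_, measure_lt_top _ _⟩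
  have := gaussianReal_absolutelyContinuous' 0 one_ne_zero h
  simp at this

lemma gaussianReal_Ici_le_stdGaussian (c : Vec d) (κ : ℝ) :
    gaussianReal 0 1 (Set.Ici κ) ≤ stdGaussian (Vec d) {z | κ * ‖c‖ ≤ inner ℝ c z} := by
  have hm : Measurable fun z : Vec d => inner ℝ c z := by fun_prop
  have h1 : stdGaussian (Vec d) {z | κ * ‖c‖ ≤ inner ℝ c z} =
      (stdGaussian (Vec d)).map (fun z => inner ℝ c z) (Set.Ici (κ * ‖c‖)) := by
    rw [Measure.map_apply hm measurableSet_Ici]; rfl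
  rw [h1, map_inner_stdGaussian_eq_map_mul, Measure.map_apply (by fun_prop) measurableSet_Ici]
  refine measure_mono fun z hz => ?_
  simp only [Set.mem_Ici, Set.mem_preimage] at hz ⊢
  rw [mul_comm]
  exact mul_le_mul_of_nonneg_left hz (norm_nonneg _)

/-- The normalized inner product is standard Gaussian. For c = 0 the quotient is 0 by convention,
and only an inequality is left. -/
lemma lintegral_exp_sq_inner_stdGaussian_le (c : Vec d) :
    ∫⁻ z, ENNReal.ofReal (Real.exp ((inner ℝ c z : ℝ) ^ 2 / ‖c‖ ^ 2 / 4)) ∂(stdGaussian (Vec d)) ≤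
      ENNReal.ofReal (√2) := by
  have hm : Measurable fun z : Vec d => (inner ℝ c z : ℝ) := by fun_prop
  have h1 := lintegral_map (μ := stdGaussian (Vec d))
    (f := fun y : ℝ => ENNReal.ofReal (Real.exp (y ^ 2 / ‖c‖ ^ 2 / 4))) (by fun_prop) hm
  rw [← h1, map_inner_stdGaussian_eq_map_mul, lintegral_map (by fun_prop) (by fun_prop),
    ← lintegral_exp_sq_div_four_gaussianReal]
  refine lintegral_mono fun z => ENNReal.ofReal_le_ofReal (Real.exp_le_exp.mpr ?_)
  rcases eq_or_ne ‖c‖ 0 with h | h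
  · simp only [h]
    simp
    positivity
  · rw [mul_pow, mul_div_cancel_left₀ _ (pow_ne_zero 2 h)]

/-- The coordinates are independent standard Gaussians, so the integral factors. -/
lemma lintegral_exp_sq_norm_stdGaussian :
    ∫⁻ z, ENNReal.ofReal (Real.exp (‖z‖ ^ 2 / 4)) ∂(stdGaussian (Vec d)) =
      ENNReal.ofReal (√2) ^ d := by
  rw [← map_pi_eq_stdGaussian, lintegral_map (by fun_prop) (by fun_prop)]
  have h : ∀ x : Fin d → ℝ, ENNReal.ofReal (Real.exp (‖(WithLp.toLp 2 x : Vec d)‖ ^ 2 / 4)) =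
      ∏ i, ENNReal.ofReal (Real.exp (x i ^ 2 / 4)) := by
    intro x
    rw [EuclideanSpace.real_norm_sq_eq, Finset.sum_div, Real.exp_sum,
      ENNReal.ofReal_prod_of_nonneg fun _ _ => (Real.exp_pos _).le]
  have hind : iIndepFun (fun (i : Fin d) (x : Fin d → ℝ) => ENNReal.ofReal (Real.exp (x i ^ 2 / 4)))
      (Measure.pi fun _ : Fin d => gaussianReal 0 1) :=
    iIndepFun_pi (μ := fun _ : Fin d => gaussianReal 0 1)
      (X := fun _ y => ENNReal.ofReal (Real.exp (y ^ 2 / 4))) fun i => by fun_prop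
  rw [lintegral_congr h, lintegral_prod_eq_prod_lintegral_of_indepFun Finset.univ _ hind
    fun i => by fun_prop]
  have h1 : ∀ i : Fin d, ∫⁻ x : Fin d → ℝ, ENNReal.ofReal (Real.exp (x i ^ 2 / 4))
      ∂(Measure.pi fun _ : Fin d => gaussianReal 0 1) = ENNReal.ofReal (√2) := by
    intro i
    rw [← lintegral_exp_sq_div_four_gaussianReal]
    exact (measurePreserving_eval (fun _ : Fin d => gaussianReal 0 1) i).lintegral_comp
      (f := fun y => ENNReal.ofReal (Real.exp (y ^ 2 / 4))) (by fun_prop)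
  simp [h1]

/-- The largest squared standardized deviation of `x` from `y` in the directions `b i`, for the
covariance matrix `S`. -/
def maxDevSq (b : Fin N → Vec d) (y : Vec d) (S : Matrix (Fin d) (Fin d) ℝ) (x : Vec d) : ℝ :=
  ⨆ i, (inner ℝ (b i) x - inner ℝ (b i) y) ^ 2 / ((b i).ofLp ⬝ᵥ S *ᵥ (b i).ofLp)

lemma norm_sq_sqrt_apply {S : Matrix (Fin d) (Fin d) ℝ} (hS : S.PosSemidef) (x : Vec d) :
    ‖toEuclideanCLM (𝕜 := ℝ) (CFC.sqrt S) x‖ ^ 2 = x.ofLp ⬝ᵥ S *ᵥ x.ofLp := by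
  rw [← real_inner_self_eq_norm_sq, ← ContinuousLinearMap.adjoint_inner_left,
    IsSelfAdjoint.adjoint_eq ((CFC.sqrt_nonneg S).isSelfAdjoint.map _),
    ← ContinuousLinearMap.comp_apply, ← ContinuousLinearMap.mul_def, ← map_mul,
    CFC.sqrt_mul_sqrt_self _ hS.nonneg, real_inner_comm, inner_toEuclideanCLM]

lemma inner_sqrt_apply {S : Matrix (Fin d) (Fin d) ℝ} (x z : Vec d) :
    inner ℝ x (toEuclideanCLM (𝕜 := ℝ) (CFC.sqrt S) z) =
      inner ℝ (toEuclideanCLM (𝕜 := ℝ) (CFC.sqrt S) x) z := by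
  rw [← ContinuousLinearMap.adjoint_inner_left,
    IsSelfAdjoint.adjoint_eq ((CFC.sqrt_nonneg S).isSelfAdjoint.map _)]

lemma measurable_maxDevSq (b : Fin N → Vec d) (y : Vec d) (S : Matrix (Fin d) (Fin d) ℝ) :
    Measurable (maxDevSq b y S) := by
  unfold maxDevSq
  exact Measurable.iSup fun i => by fun_prop

/-- The sample is `y` plus the square root of `S` applied to a standard Gaussian z. The supremum is
at most ‖z‖², which costs (√2)^d, while a sum over the arms costs N√2; both are absorbed by the
constant 3/2, the second because √2 ≤ √N. -/
lemma lintegral_exp_maxDevSq_le (hN : 2 ≤ N) (b : Fin N → Vec d) (y : Vec d)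
    {S : Matrix (Fin d) (Fin d) ℝ} (hS : S.PosSemidef) :
    ∫⁻ x, ENNReal.ofReal (Real.exp (maxDevSq b y S x / 4)) ∂(multivariateGaussian y S) ≤
      ENNReal.ofReal (Real.exp (3 / 2 * min (d : ℝ) (Real.log N))) := by
  have : NeZero N := ⟨by omega⟩
  set c : Fin N → Vec d := fun i => toEuclideanCLM (𝕜 := ℝ) (CFC.sqrt S) (b i) with hc
  have hdev : ∀ z, maxDevSq b y S (y + toEuclideanCLM (𝕜 := ℝ) (CFC.sqrt S) z) =
      ⨆ i, (inner ℝ (c i) z : ℝ) ^ 2 / ‖c i‖ ^ 2 := by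
    intro z
    unfold maxDevSq
    congr 1
    ext i
    rw [inner_add_right, add_sub_cancel_left, inner_sqrt_apply, hc, norm_sq_sqrt_apply hS]
  have hmeas := measurable_maxDevSq b y S
  rw [multivariateGaussian, lintegral_map (by fun_prop) (by fun_prop)]
  simp only [hdev]
  have hs2 : √2 ≤ Real.exp (1 / 2 : ℝ) := by
    rw [Real.exp_half]
    exact Real.sqrt_le_sqrt (by linarith [Real.add_one_le_exp (1 : ℝ)])
  rcases min_choice (d : ℝ) (Real.log N) with h | h
  · rw [h]
    refine (lintegral_mono (g := fun z : Vec d => ENNReal.ofReal (Real.exp (‖z‖ ^ 2 / 4)))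
      fun z => ENNReal.ofReal_le_ofReal (Real.exp_le_exp.mpr ?_)).trans ?_
    · gcongr
      refine ciSup_le fun i => div_le_of_le_mul₀ (by positivity) (by positivity) ?_
      rw [← mul_pow, mul_comm]
      exact sq_le_sq.mpr ((abs_real_inner_le_norm _ _).trans (le_abs_self _))
    · rw [lintegral_exp_sq_norm_stdGaussian, ← ENNReal.ofReal_pow (Real.sqrt_nonneg _)]
      refine ENNReal.ofReal_le_ofReal ?_
      calc √2 ^ d ≤ Real.exp (1 / 2 : ℝ) ^ d := by gcongr
        _ = Real.exp (d * (1 / 2)) := by rw [← Real.exp_nat_mul]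
        _ ≤ _ := Real.exp_le_exp.mpr (by nlinarith [Nat.cast_nonneg (α := ℝ) d])
  · rw [h]
    have hNpos : (0 : ℝ) < N := by positivity
    refine (lintegral_mono (g := fun z : Vec d => ∑ i,
      ENNReal.ofReal (Real.exp ((inner ℝ (c i) z : ℝ) ^ 2 / ‖c i‖ ^ 2 / 4))) fun z => ?_).trans ?_
    · obtain ⟨i, hi⟩ := exists_eq_ciSup_of_finite
        (f := fun i => (inner ℝ (c i) z : ℝ) ^ 2 / ‖c i‖ ^ 2)
      rw [← hi]
      exact Finset.single_le_sum (f := fun i => ENNReal.ofReal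
        (Real.exp ((inner ℝ (c i) z : ℝ) ^ 2 / ‖c i‖ ^ 2 / 4))) (fun _ _ => zero_le)
        (Finset.mem_univ i)
    · rw [lintegral_finsetSum _ fun i _ => by fun_prop]
      refine (Finset.sum_le_sum fun i _ => lintegral_exp_sq_inner_stdGaussian_le (c i)).trans ?_
      rw [Finset.sum_const, Finset.card_univ, Fintype.card_fin, nsmul_eq_mul,
        ← ENNReal.ofReal_natCast, ← ENNReal.ofReal_mul hNpos.le]
      refine ENNReal.ofReal_le_ofReal ?_
      have h2 : √2 ≤ Real.exp (1 / 2 * Real.log N) := by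
        rw [one_div_mul_eq_div, Real.exp_half, Real.exp_log hNpos]
        exact Real.sqrt_le_sqrt (by exact_mod_cast hN)
      calc (N : ℝ) * √2 ≤ N * Real.exp (1 / 2 * Real.log N) := by gcongr
        _ = Real.exp (Real.log N) * Real.exp (1 / 2 * Real.log N) := by rw [Real.exp_log hNpos]
        _ = _ := by rw [← Real.exp_add]; congr 1; ring

/-- Anti-concentration of a Gaussian vector in a fixed direction. -/
lemma gaussianReal_Ici_le_multivariateGaussian {S : Matrix (Fin d) (Fin d) ℝ} (hS : S.PosSemidef)
    (u y : Vec d) {κ c : ℝ} (h : c - κ * √(u.ofLp ⬝ᵥ S *ᵥ u.ofLp) ≤ inner ℝ u y) :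
    gaussianReal 0 1 (Set.Ici κ) ≤ multivariateGaussian y S {x | c ≤ inner ℝ u x} := by
  rw [multivariateGaussian, Measure.map_apply (by fun_prop)
    (measurableSet_le (by fun_prop) (by fun_prop))]
  refine (gaussianReal_Ici_le_stdGaussian (toEuclideanCLM (𝕜 := ℝ) (CFC.sqrt S) u) κ).trans
    (measure_mono fun z hz => ?_)
  change c ≤ inner ℝ u (y + toEuclideanCLM (𝕜 := ℝ) (CFC.sqrt S) z)
  change κ * _ ≤ _ at hz
  rw [inner_add_right, inner_sqrt_apply]
  rw [← norm_sq_sqrt_apply hS, Real.sqrt_sq (norm_nonneg _)] at h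
  linarith

end MultivariateGaussian

/-! ### Measurability of the history-dependent quantities -/

section Measurability

open Matrix
open scoped ENNReal

/-- Arms, rewards of the arms played, and contexts before round `t` are measurable. -/
structure HistoryMeasurable {Ω : Type*} [MeasurableSpace Ω] {d N : ℕ}
    (b : ℕ → Fin N → Ω → Vec d) (r : ℕ → Fin N → Ω → ℝ) (a : ℕ → Ω → Fin N) (t : ℕ) : Prop where
  arm : ∀ τ ∈ Finset.Ico 1 t, Measurable (a τ)
  reward : ∀ τ ∈ Finset.Ico 1 t, Measurable fun ω => r τ (a τ ω) ω
  context : ∀ τ ∈ Finset.Ico 1 t, ∀ i, Measurable (b τ i)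

variable {Ω : Type*} {d N : ℕ} {mΩ : MeasurableSpace Ω}

lemma measurable_apply_index {β : Type*} [MeasurableSpace β] {f : Fin N → Ω → β}
    (hf : ∀ i, Measurable (f i)) {k : Ω → Fin N} (hk : Measurable k) :
    Measurable fun ω => f (k ω) ω :=
  (measurable_from_prod_countable_right (f := fun p : Fin N × Ω => f p.1 p.2) hf).comp
    (hk.prodMk measurable_id)

lemma measurable_matrix_inv_apply {M : Ω → Matrix (Fin d) (Fin d) ℝ}
    (hM : ∀ i j, Measurable fun ω => M ω i j) (i j : Fin d) :
    Measurable fun ω => (M ω)⁻¹ i j := by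
  have hM' : Measurable (fun ω => (fun i j => M ω i j : Fin d → Fin d → ℝ)) :=
    measurable_pi_lambda _ fun i => measurable_pi_lambda _ fun j => hM i j
  have hdet : Continuous fun A : Fin d → Fin d → ℝ => (Matrix.of A).det :=
    Continuous.matrix_det continuous_id
  have hadj : Continuous fun A : Fin d → Fin d → ℝ => (Matrix.of A).adjugate i j :=
    (Continuous.matrix_adjugate (A := fun A : Fin d → Fin d → ℝ => Matrix.of A)
      continuous_id).matrix_elem i j
  have h := (hdet.measurable.comp hM').inv.mul (hadj.measurable.comp hM')
  simp only [Matrix.inv_def, Ring.inverse_eq_inv', Matrix.smul_apply, smul_eq_mul]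
  exact h

lemma measurable_dotProduct_mulVec {A : Ω → Matrix (Fin d) (Fin d) ℝ}
    (hA : ∀ i j, Measurable fun ω => A ω i j) {u w : Ω → Fin d → ℝ}
    (hu : ∀ i, Measurable fun ω => u ω i) (hw : ∀ i, Measurable fun ω => w ω i) :
    Measurable fun ω => u ω ⬝ᵥ A ω *ᵥ w ω := by
  simp only [dotProduct, mulVec]
  fun_prop

variable {μ : Vec d} {b : ℕ → Fin N → Ω → Vec d} {r : ℕ → Fin N → Ω → ℝ} {a : ℕ → Ω → Fin N}
  {t : ℕ}

namespace HistoryMeasurable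

lemma playedContext (h : HistoryMeasurable b r a t) {τ : ℕ} (hτ : τ ∈ Finset.Ico 1 t) :
    Measurable fun ω => b τ (a τ ω) ω :=
  measurable_apply_index (h.context τ hτ) (h.arm τ hτ)

lemma playedContext_apply (h : HistoryMeasurable b r a t) {τ : ℕ} (hτ : τ ∈ Finset.Ico 1 t)
    (i : Fin d) : Measurable fun ω => (b τ (a τ ω) ω).ofLp i :=
  (measurable_pi_apply i).comp ((WithLp.measurable_ofLp 2 _).comp (h.playedContext hτ))

lemma designMatrix_apply (h : HistoryMeasurable b r a t) (i j : Fin d) :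
    Measurable fun ω => designMatrix b a t ω i j := by
  simp only [designMatrix, Matrix.add_apply, Matrix.sum_apply, vecMulVec_apply]
  refine measurable_const.add (Finset.measurable_sum _ fun τ hτ => ?_)
  exact (h.playedContext_apply hτ i).mul (h.playedContext_apply hτ j)

lemma designMatrix_inv_apply (h : HistoryMeasurable b r a t) (i j : Fin d) :
    Measurable fun ω => (designMatrix b a t ω)⁻¹ i j :=
  measurable_matrix_inv_apply h.designMatrix_apply i j

lemma noiseSum_apply (h : HistoryMeasurable b r a t) (i : Fin d) :
    Measurable fun ω => noiseSum μ b r a t ω i := by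
  simp only [noiseSum, Finset.sum_apply, Pi.smul_apply]
  refine Finset.measurable_sum _ fun τ hτ => ?_
  exact ((h.reward τ hτ).sub (h.playedContext hτ).inner_const).mul (h.playedContext_apply hτ i)

lemma selfNormSq (h : HistoryMeasurable b r a t) : Measurable (selfNormSq μ b r a t) :=
  measurable_dotProduct_mulVec h.designMatrix_inv_apply h.noiseSum_apply h.noiseSum_apply

lemma estimate (h : HistoryMeasurable b r a t) : Measurable (estimate b r a t) := by
  refine (WithLp.measurable_toLp 2 _).comp (measurable_pi_lambda _ fun i => ?_)
  have h1 : ∀ j, Measurable fun ω =>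
      (∑ τ ∈ Finset.Ico 1 t, r τ (a τ ω) ω • (b τ (a τ ω) ω).ofLp) j := by
    intro j
    simp only [Finset.sum_apply, Pi.smul_apply]
    refine Finset.measurable_sum _ fun τ hτ => ?_
    exact (h.reward τ hτ).mul (h.playedContext_apply hτ j)
  simp only [mulVec, dotProduct]
  exact Finset.measurable_sum _ fun j _ => (h.designMatrix_inv_apply i j).mul (h1 j)

lemma width (h : HistoryMeasurable b r a t) {i : Fin N} (hb : Measurable (b t i)) :
    Measurable (width b a t i) := by
  refine Measurable.sqrt (measurable_dotProduct_mulVec h.designMatrix_inv_apply ?_ ?_) <;>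
  · intro j
    fun_prop

lemma det_designMatrix (h : HistoryMeasurable b r a t) :
    Measurable fun ω => (designMatrix b a t ω).det := by
  have hM' : Measurable (fun ω => (fun i j => designMatrix b a t ω i j : Fin d → Fin d → ℝ)) :=
    measurable_pi_lambda _ fun i => measurable_pi_lambda _ fun j => h.designMatrix_apply i j
  have hdet : Continuous fun A : Fin d → Fin d → ℝ => (Matrix.of A).det :=
    Continuous.matrix_det continuous_id
  exact hdet.measurable.comp hM'

end HistoryMeasurable

lemma measurable_gap (hb : ∀ i, Measurable (b t i)) (i : Fin N) : Measurable (gap μ b t i) := by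
  unfold gap
  refine (Measurable.iSup fun j => ?_).sub ?_
  · have := hb j
    fun_prop
  · have := hb i
    fun_prop

end Measurability

/-! ### The filtration -/

section Info

open Matrix
open scoped ENNReal

variable {Ω : Type*} {d N : ℕ} {b : ℕ → Fin N → Ω → Vec d} {r : ℕ → Fin N → Ω → ℝ}
  {a : ℕ → Ω → Fin N} {t : ℕ}

lemma history_mono {s t : ℕ} (h : s ≤ t) : history b r a s ≤ history b r a t := by
  refine iSup₂_le fun τ hτ => ?_
  refine le_iSup₂_of_le (f := fun τ (_ : τ ∈ Finset.Ico 1 t) =>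
    MeasurableSpace.comap (a τ) inferInstance ⊔
    MeasurableSpace.comap (fun ω => r τ (a τ ω) ω) inferInstance ⊔
    ⨆ i, MeasurableSpace.comap (b τ i) inferInstance) τ ?_ le_rfl
  simp only [Finset.mem_Ico] at hτ ⊢
  omega

lemma le_history {τ : ℕ} (hτ : τ ∈ Finset.Ico 1 t) :
    MeasurableSpace.comap (a τ) inferInstance ⊔
    MeasurableSpace.comap (fun ω => r τ (a τ ω) ω) inferInstance ⊔
    (⨆ i, MeasurableSpace.comap (b τ i) inferInstance) ≤ history b r a t :=
  le_iSup₂_of_le (f := fun τ (_ : τ ∈ Finset.Ico 1 t) =>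
    MeasurableSpace.comap (a τ) inferInstance ⊔
    MeasurableSpace.comap (fun ω => r τ (a τ ω) ω) inferInstance ⊔
    ⨆ i, MeasurableSpace.comap (b τ i) inferInstance) τ hτ le_rfl

lemma info_le_info_succ (ht : 1 ≤ t) : info b r a t ≤ info b r a (t + 1) := by
  refine sup_le ((history_mono (Nat.le_succ t)).trans le_sup_left) ?_
  refine le_trans ?_ le_sup_left
  exact le_sup_right.trans (le_history (Finset.mem_Ico.mpr ⟨ht, Nat.lt_succ_self t⟩))

/-- Contexts of round 0 enter `info` at index 0 and nowhere later, so the index is clamped at 1 to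
obtain a filtration. -/
lemma info_mono : Monotone fun t => info b r a (max 1 t) := by
  refine monotone_nat_of_le_succ fun t => ?_
  rcases Nat.eq_zero_or_pos t with rfl | h
  · simp
  · rw [max_eq_right (by omega), max_eq_right (by omega)]
    exact info_le_info_succ h

lemma info_le {mΩ : MeasurableSpace Ω} (hb : ∀ t, 1 ≤ t → ∀ i, Measurable (b t i))
    (hr : ∀ t, 1 ≤ t → ∀ i, Measurable (r t i)) (ha : ∀ t, 1 ≤ t → Measurable (a t))
    (ht : 1 ≤ t) : info b r a t ≤ mΩ := by
  refine sup_le (iSup₂_le fun τ hτ => ?_) (iSup_le fun i => (hb t ht i).comap_le)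
  have h1 := (Finset.mem_Ico.mp hτ).1
  exact sup_le (sup_le (ha τ h1).comap_le
    (measurable_apply_index (hr τ h1) (ha τ h1)).comap_le)
    (iSup_le fun i => (hb τ h1 i).comap_le)

lemma measurable_context_info (i : Fin N) : Measurable[info b r a t] (b t i) := by
  refine Measurable.of_comap_le (le_trans ?_ le_sup_right)
  exact le_iSup (fun i => MeasurableSpace.comap (b t i) inferInstance) i

lemma historyMeasurable_info : @HistoryMeasurable Ω (info b r a t) d N b r a t :=
  @HistoryMeasurable.mk Ω (info b r a t) d N b r a t
    (fun _ hτ => Measurable.of_comap_le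
      ((le_sup_left.trans le_sup_left).trans ((le_history hτ).trans le_sup_left)))
    (fun _ hτ => Measurable.of_comap_le
      ((le_sup_right.trans le_sup_left).trans ((le_history hτ).trans le_sup_left)))
    (fun τ hτ i => Measurable.of_comap_le
      (((le_iSup (fun i => MeasurableSpace.comap (b τ i) inferInstance) i).trans
        le_sup_right).trans ((le_history hτ).trans le_sup_left)))

end Info

/-! ### The self-normalized tail bound -/

section SelfNormalized

open Matrix
open scoped ENNReal

variable {Ω : Type*} {d N : ℕ} {mΩ : MeasurableSpace Ω}

lemma lintegral_eq_sum_setLIntegral_fiber {P : Measure Ω} {k : Ω → Fin N} (hk : Measurable k)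
    (f : Ω → ℝ≥0∞) : ∫⁻ ω, f ω ∂P = ∑ i, ∫⁻ ω in k ⁻¹' {i}, f ω ∂P := by
  rw [← lintegral_biUnion_finset (fun i _ j _ hij => ?_) (fun i _ => hk (measurableSet_singleton i))]
  · have : ⋃ i ∈ (Finset.univ : Finset (Fin N)), k ⁻¹' {i} = Set.univ := by
      ext ω; simp
    rw [this, Measure.restrict_univ]
  · refine Set.disjoint_left.mpr fun ω h1 h2 => hij ?_
    rw [← (show k ω = i from h1), ← (show k ω = j from h2)]

variable {P : Measure Ω} {R : ℝ} {μ : Vec d} {v : ℕ → ℝ}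
  {b : ℕ → Fin N → Ω → Vec d} {r : ℕ → Fin N → Ω → ℝ} {a : ℕ → Ω → Fin N} {s : ℕ → Ω → Vec d}

lemma IsLinearBandit.info_le (hB : IsLinearBandit P R μ b r a) {t : ℕ} (ht : 1 ≤ t) :
    info b r a t ≤ mΩ :=
  LinBandit.info_le hB.measurable_context hB.measurable_reward hB.measurable_arm ht

variable [IsProbabilityMeasure P]

/-- On the event that arm `i` is played, the noise of arm `i` is still sub-Gaussian given the
history and the contexts. -/
lemma setLIntegral_arm_exp_noise_le (hB : IsLinearBandit P R μ b r a)
    (hT : IsThompsonSampling P v b r a s) {t : ℕ} (ht : 1 ≤ t) (i : Fin N) (l : ℝ)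
    (ψ : Ω → ℝ≥0∞) (hψ : Measurable[info b r a t] ψ) :
    ∫⁻ ω in a t ⁻¹' {i}, ψ ω * ENNReal.ofReal
        (Real.exp (l * (r t i ω - inner ℝ (b t i ω) μ))) ∂P ≤
      ENNReal.ofReal (Real.exp (l ^ 2 * R ^ 2 / 2)) * ∫⁻ ω in a t ⁻¹' {i}, ψ ω ∂P := by
  have hm := hB.info_le ht
  have hD : MeasurableSet (a t ⁻¹' {i}) := hB.measurable_arm t ht (measurableSet_singleton i)
  have hY : Measurable fun ω i => r t i ω :=
    measurable_pi_lambda _ fun i => hB.measurable_reward t ht i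
  have hind : ∀ S : Set (Fin N → ℝ), MeasurableSet S →
      P⟦a t ⁻¹' {i} ∩ (fun ω i => r t i ω) ⁻¹' S | info b r a t⟧ =ᵐ[P]
        P⟦a t ⁻¹' {i} | info b r a t⟧ * P⟦(fun ω i => r t i ω) ⁻¹' S | info b r a t⟧ := by
    intro S hS
    have h := hT.choice_condIndep t ht (Set.univ ×ˢ {i}) S
      (MeasurableSet.univ.prod (measurableSet_singleton i)) hS
    have h1 : (fun ω => (s t ω, a t ω)) ⁻¹' (Set.univ ×ˢ {i}) = a t ⁻¹' {i} := by
      ext ω; simp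
    rwa [h1] at h
  -- The conditioning variable is the identity map into the smaller σ-algebra, which generates
  -- exactly that σ-algebra.
  have hX : @Measurable Ω Ω mΩ (info b r a t) id := measurable_id'' hm
  have key := fun (F : Ω × (Fin N → ℝ) → ℝ≥0∞)
    (hF : @Measurable _ _ ((info b r a t).prod MeasurableSpace.pi) _ F) =>
    @setLIntegral_eq_lintegral_condProb Ω Ω (Fin N → ℝ) (info b r a t) mΩ (info b r a t) P _ _
      id hX MeasurableSpace.comap_id.symm _ hY _ hD hind F hF
  have hψ1 : @Measurable _ _ ((info b r a t).prod (MeasurableSpace.pi : MeasurableSpace (Fin N → ℝ)))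
      _ fun z : Ω × (Fin N → ℝ) => ψ z.1 := hψ.comp measurable_fst
  have hin : @Measurable _ _ ((info b r a t).prod (MeasurableSpace.pi : MeasurableSpace (Fin N → ℝ)))
      _ fun z : Ω × (Fin N → ℝ) => (inner ℝ (b t i z.1) μ : ℝ) :=
    (Measurable.inner_const (measurable_context_info i)).comp measurable_fst
  have hy : @Measurable _ _ ((info b r a t).prod (MeasurableSpace.pi : MeasurableSpace (Fin N → ℝ)))
      _ fun z : Ω × (Fin N → ℝ) => z.2 i := (measurable_pi_apply i).comp measurable_snd
  have k1 := key (fun z => ψ z.1 * ENNReal.ofReal (Real.exp (l * (z.2 i - inner ℝ (b t i z.1) μ))))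
    (hψ1.mul (Real.measurable_exp.comp ((hy.sub hin).const_mul l)).ennreal_ofReal)
  have k2 := key (fun z => ψ z.1) hψ1
  simp only [id] at k1 k2
  rw [k1, k2]
  simp only [← mul_assoc]
  have hg : Measurable fun ω => Real.exp (l * (r t i ω - inner ℝ (b t i ω) μ)) := by
    have := hB.measurable_reward t ht i
    have := hB.measurable_context t ht i
    fun_prop
  refine lintegral_mul_ofReal_le_of_condExp_le hm (hB.integrable_exp_noise t ht i l) hg
    (ae_of_all _ fun ω => (Real.exp_pos _).le) (hB.subGaussian_noise t ht i l) ?_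
  exact (stronglyMeasurable_condExp.measurable.ennreal_ofReal).mul hψ

/-- The logarithmic increment of the self-normalized exponential supermartingale. -/
def selfNormIncrement (R : ℝ) (μ : Vec d) (b : ℕ → Fin N → Ω → Vec d) (r : ℕ → Fin N → Ω → ℝ)
    (a : ℕ → Ω → Fin N) (t : ℕ) (ω : Ω) : ℝ :=
  (selfNormSq μ b r a (t + 1) ω / (2 * R ^ 2) - Real.log (designMatrix b a (t + 1) ω).det / 2) -
    (selfNormSq μ b r a t ω / (2 * R ^ 2) - Real.log (designMatrix b a t ω).det / 2)

/-- The determinant ratio 1 + w² supplies the normalizing factor of the one-dimensional Gaussian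
mixture. -/
lemma exp_selfNormIncrement {t : ℕ} (ht : 1 ≤ t) (ω : Ω) :
    Real.exp (selfNormIncrement R μ b r a t ω) =
      (√(1 + width b a t (a t ω) ω ^ 2))⁻¹ * Real.exp
        ((2 * (r t (a t ω) ω - inner ℝ (b t (a t ω) ω) μ) * ((b t (a t ω) ω).ofLp ⬝ᵥ
          (designMatrix b a t ω)⁻¹ *ᵥ noiseSum μ b r a t ω) +
        (r t (a t ω) ω - inner ℝ (b t (a t ω) ω) μ) ^ 2 * width b a t (a t ω) ω ^ 2 -
        ((b t (a t ω) ω).ofLp ⬝ᵥ (designMatrix b a t ω)⁻¹ *ᵥ noiseSum μ b r a t ω) ^ 2) /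
      (1 + width b a t (a t ω) ω ^ 2) / (2 * R ^ 2)) := by
  have hdet := zero_lt_one.trans_le (one_le_det_designMatrix (b := b) (a := a) ht ω)
  have hw : 0 < 1 + width b a t (a t ω) ω ^ 2 := by positivity
  have h1 : (√(1 + width b a t (a t ω) ω ^ 2))⁻¹ =
      Real.exp (-(Real.log (1 + width b a t (a t ω) ω ^ 2) / 2)) := by
    rw [Real.exp_neg, Real.exp_half, Real.exp_log hw]
  rw [h1, ← Real.exp_add, selfNormIncrement, selfNormSq_succ ht, designMatrix_succ ht,
    det_add_vecMulVec_self (posDef_designMatrix t ω), ← sq_width, Real.log_mul hdet.ne' hw.ne']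
  congr 1
  ring

/-- The arm played is not known given `info`, so the integral is split over the arms. On each piece
the noise belongs to a fixed arm and the mixture bound applies to the restricted measure. -/
lemma condMeanLEOne_exp_selfNormIncrement (hR : 0 < R) (hB : IsLinearBandit P R μ b r a)
    (hT : IsThompsonSampling P v b r a s) {t : ℕ} (ht : 1 ≤ t) :
    CondMeanLEOne P (info b r a t)
      (fun ω => ENNReal.ofReal (Real.exp (selfNormIncrement R μ b r a t ω))) := by
  intro ψ hψ
  have hm := hB.info_le ht
  have hist := historyMeasurable_info (b := b) (r := r) (a := a) (t := t)
  rw [lintegral_eq_sum_setLIntegral_fiber (hB.measurable_arm t ht) ψ,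
    lintegral_eq_sum_setLIntegral_fiber (hB.measurable_arm t ht)]
  refine Finset.sum_le_sum fun i _ => ?_
  have hη : Measurable fun ω => r t i ω - inner ℝ (b t i ω) μ :=
    (hB.measurable_reward t ht i).sub (hB.measurable_context t ht i).inner_const
  have hb : ∀ j, Measurable[info b r a t] fun ω => (b t i ω).ofLp j := fun j =>
    (measurable_pi_apply j).comp ((WithLp.measurable_ofLp 2 _).comp (measurable_context_info i))
  have h := lintegral_exp_mixture_le hm (ν := P.restrict (a t ⁻¹' {i})) hη hR
    (setLIntegral_arm_exp_noise_le hB hT ht i)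
    (x := fun ω => (b t i ω).ofLp ⬝ᵥ (designMatrix b a t ω)⁻¹ *ᵥ noiseSum μ b r a t ω)
    (w := fun ω => width b a t i ω ^ 2)
    (measurable_dotProduct_mulVec hist.designMatrix_inv_apply hb hist.noiseSum_apply)
    ((hist.width (measurable_context_info i)).pow_const 2) (fun ω => sq_nonneg _) hψ
  refine le_trans (le_of_eq ?_) h
  refine setLIntegral_congr_fun (hB.measurable_arm t ht (measurableSet_singleton i)) fun ω hω => ?_
  have hω' : a t ω = i := hω
  simp only [exp_selfNormIncrement ht, hω']

lemma measurable_selfNormIncrement {t : ℕ} (ht : 1 ≤ t) :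
    Measurable[info b r a (t + 1)] (selfNormIncrement R μ b r a t) := by
  have h1 : @HistoryMeasurable Ω (info b r a (t + 1)) d N b r a (t + 1) := historyMeasurable_info
  have h0 : @HistoryMeasurable Ω (info b r a t) d N b r a t := historyMeasurable_info
  have hle : info b r a t ≤ info b r a (t + 1) := info_le_info_succ ht
  refine Measurable.sub ?_ (Measurable.mono (Measurable.sub (h0.selfNormSq.div_const _)
    ((Real.measurable_log.comp h0.det_designMatrix).div_const _)) hle le_rfl)
  exact Measurable.sub (h1.selfNormSq.div_const _)
    ((Real.measurable_log.comp h1.det_designMatrix).div_const _)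

/-- The self-normalized tail bound for the noise. -/
lemma measure_selfNormSq_gt_le (hR : 0 < R) (hB : IsLinearBandit P R μ b r a)
    (hT : IsThompsonSampling P v b r a s) {t : ℕ} (ht : 1 ≤ t) {ε : ℝ} (hε : 0 < ε) :
    P {ω | R ^ 2 * (d * Real.log t + 2 * Real.log (1 / ε)) < selfNormSq μ b r a t ω} ≤
      ENNReal.ofReal ε := by
  have h := measure_exp_sum_gt_le (P := P) (info_mono (b := b) (r := r) (a := a))
    (fun t => hB.info_le (le_max_left 1 t)) (ξ := selfNormIncrement R μ b r a) (s := 1) (T := t)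
    (fun τ hτ => by
      have h1 := (Finset.mem_Ico.mp hτ).1
      rw [max_eq_right (by omega)]
      exact measurable_selfNormIncrement h1)
    (fun τ hτ => by
      have h1 := (Finset.mem_Ico.mp hτ).1
      simp only [max_eq_right h1]
      exact condMeanLEOne_exp_selfNormIncrement hR hB hT h1) hε
  refine le_trans (measure_mono fun ω hω => ?_) h
  change R ^ 2 * (d * Real.log t + 2 * Real.log (1 / ε)) < selfNormSq μ b r a t ω at hω
  change Real.log (1 / ε) < ∑ τ ∈ Finset.Ico 1 t, selfNormIncrement R μ b r a τ ω
  have htel : ∑ τ ∈ Finset.Ico 1 t, selfNormIncrement R μ b r a τ ω =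
      selfNormSq μ b r a t ω / (2 * R ^ 2) - Real.log (designMatrix b a t ω).det / 2 := by
    simp only [selfNormIncrement]
    rw [Finset.sum_Ico_sub (fun τ => selfNormSq μ b r a τ ω / (2 * R ^ 2) -
      Real.log (designMatrix b a τ ω).det / 2) ht]
    simp [selfNormSq, noiseSum_one, designMatrix_one]
  rw [htel]
  have hlog := log_det_designMatrix_le (a := a) hB.norm_context_le ht ω
  have h2 : (d * Real.log t + 2 * Real.log (1 / ε)) / 2 < selfNormSq μ b r a t ω / (2 * R ^ 2) := by
    rw [lt_div_iff₀ (by positivity)]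
    linarith
  linarith

end SelfNormalized

/-! ### Unsaturated arms and the deterministic gap inequality -/

section Deterministic

open Matrix
open scoped ENNReal

variable {N : ℕ}

/-- The least value of `min ((g sᵢ)², 1)` over the arms `i` whose gap is at most `g sᵢ`, where `θ`
are the mean rewards and `s` the widths of the arms. -/
def unsaturatedWidthSq (g : ℝ) (θ s : Fin N → ℝ) : ℝ :=
  ⨅ i, if (⨆ j, θ j) - θ i ≤ g * s i then min ((g * s i) ^ 2) 1 else 1

variable {g c : ℝ} {θ s y : Fin N → ℝ}

lemma unsaturatedWidthSq_le (i : Fin N) :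
    unsaturatedWidthSq g θ s ≤
      if (⨆ j, θ j) - θ i ≤ g * s i then min ((g * s i) ^ 2) 1 else 1 :=
  ciInf_le (Set.finite_range _).bddBelow i

/-- Playing optimistically leads to an unsaturated arm. -/
lemma unsaturatedWidthSq_le_of_optimistic {k : Fin N} (hs : 0 ≤ s k) (hc : c ≤ g)
    (h : |y k - θ k| ≤ c * s k) (hopt : ⨆ j, θ j ≤ y k) :
    unsaturatedWidthSq g θ s ≤ min ((g * s k) ^ 2) 1 := by
  have h1 : (⨆ j, θ j) - θ k ≤ g * s k := by
    have := le_abs_self (y k - θ k)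
    have := mul_le_mul_of_nonneg_right hc hs
    linarith
  have := unsaturatedWidthSq_le (g := g) (θ := θ) (s := s) k
  rwa [if_pos h1] at this

variable [NeZero N]

lemma unsaturatedWidthSq_nonneg : 0 ≤ unsaturatedWidthSq g θ s := by
  refine le_ciInf fun i => ?_
  split_ifs
  · exact le_min (sq_nonneg _) zero_le_one
  · exact zero_le_one

lemma unsaturatedWidthSq_le_one : unsaturatedWidthSq g θ s ≤ 1 := by
  refine (unsaturatedWidthSq_le (0 : Fin N)).trans ?_
  split_ifs
  · exact min_le_right _ _
  · exact le_rfl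

/-- If the minimum is attained at a saturated arm, it equals 1. An optimal arm has gap zero, hence
is unsaturated with value at most 1, so it attains the minimum too. -/
lemma exists_unsaturatedWidthSq_eq (hg : 0 ≤ g) (hs : ∀ i, 0 ≤ s i) :
    ∃ i, (⨆ j, θ j) - θ i ≤ g * s i ∧ unsaturatedWidthSq g θ s = min ((g * s i) ^ 2) 1 := by
  obtain ⟨i, hi⟩ := exists_eq_ciInf_of_finite
    (f := fun i => if (⨆ j, θ j) - θ i ≤ g * s i then min ((g * s i) ^ 2) 1 else 1)
  change _ = unsaturatedWidthSq g θ s at hi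
  by_cases h : (⨆ j, θ j) - θ i ≤ g * s i
  · exact ⟨i, h, by rw [← hi, if_pos h]⟩
  · rw [if_neg h] at hi
    obtain ⟨k, hk⟩ := exists_eq_ciSup_of_finite (f := θ)
    have hk' : (⨆ j, θ j) - θ k ≤ g * s k := by
      rw [← hk, sub_self]
      exact mul_nonneg hg (hs k)
    refine ⟨k, hk', le_antisymm ?_ ?_⟩
    · have := unsaturatedWidthSq_le (g := g) (θ := θ) (s := s) k
      rwa [if_pos hk'] at this
    · rw [← hi]
      exact min_le_right _ _

/-- The gap of the arm that maximizes the perturbed mean rewards `y`. -/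
lemma gap_le_of_argmax (hg : 0 < g) (hc : 0 ≤ c) (hs : ∀ i, 0 ≤ s i) {k : Fin N}
    (h : ∀ i, |y i - θ i| ≤ c * s i) (hk : ∀ i, y i ≤ y k) (hgap : (⨆ j, θ j) - θ k ≤ 1) :
    (⨆ j, θ j) - θ k ≤ (g + c) * (√(unsaturatedWidthSq g θ s) / g + s k) := by
  obtain ⟨i, hi, hX⟩ := exists_unsaturatedWidthSq_eq (θ := θ) hg.le hs
  rw [hX]
  rcases le_total ((g * s i) ^ 2) 1 with h1 | h1
  · rw [min_eq_left h1, Real.sqrt_sq (mul_nonneg hg.le (hs i)), mul_div_cancel_left₀ _ hg.ne']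
    have h2 := neg_abs_le (y k - θ k)
    have h3 := le_abs_self (y k - θ k)
    have h4 := neg_abs_le (y i - θ i)
    have h5 := h i
    have h6 := h k
    have h7 := hk i
    have h8 := mul_nonneg hg.le (hs k)
    nlinarith
  · rw [min_eq_right h1, Real.sqrt_one]
    have h2 : 1 ≤ (g + c) * (1 / g) := by
      rw [mul_one_div, le_div_iff₀ hg]
      linarith
    have h3 := mul_nonneg (show 0 ≤ g + c by linarith) (hs k)
    linarith

end Deterministic

/-! ### An exponential moment bound for truncated rewards of an event -/

section ExponentialBounds

open Matrix
open scoped ENNReal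

lemma half_le_one_sub_exp_neg {x : ℝ} (h0 : 0 ≤ x) (h1 : x ≤ 1) : x / 2 ≤ 1 - Real.exp (-x) := by
  have h2 : Real.exp (-x) ≤ 1 / (1 + x) := by
    rw [Real.exp_neg, ← one_div]
    exact one_div_le_one_div_of_le (by linarith) (by linarith [Real.add_one_le_exp x])
  have h3 : 1 / (1 + x) ≤ 1 - x / 2 := by
    rw [div_le_iff₀ (by linarith)]
    nlinarith
  linarith

/-- With p = ν(O), the mean of exp(-x 1_O) is 1 - p(1 - e^{-x}) ≤ 1 - qx/2 ≤ exp(-qx/2). The bound 1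
- e^{-x} ≥ x/2 needs x ≤ 1, which is why `unsaturatedWidthSq` is truncated. -/
lemma lintegral_exp_sub_indicator_le_one {E : Type*} [MeasurableSpace E] {ν : Measure E}
    [IsProbabilityMeasure ν] {O : Set E} (hO : MeasurableSet O) {q x : ℝ} (hq : q ≤ ν.real O)
    (h0 : 0 ≤ x) (h1 : x ≤ 1) :
    ∫⁻ z, ENNReal.ofReal (Real.exp (q * x / 2 - O.indicator (fun _ => x) z)) ∂ν ≤ 1 := by
  have h : ∀ z, Real.exp (q * x / 2 - O.indicator (fun _ => x) z) =
      Real.exp (q * x / 2) * (1 - O.indicator (fun _ => 1 - Real.exp (-x)) z) := by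
    intro z
    by_cases hz : z ∈ O
    · simp [hz, Real.exp_sub, Real.exp_neg]
      rfl
    · simp [hz]
  have hi : Integrable (O.indicator fun _ => 1 - Real.exp (-x)) ν :=
    (integrable_const _).indicator hO
  rw [← ofReal_integral_eq_lintegral_ofReal]
  · rw [← ENNReal.ofReal_one]
    refine ENNReal.ofReal_le_ofReal ?_
    simp only [h]
    rw [integral_const_mul, integral_sub (integrable_const _) hi, integral_indicator_const _ hO]
    simp only [integral_const, probReal_univ, smul_eq_mul, one_mul]
    have h2 := half_le_one_sub_exp_neg h0 h1
    have h3 : q * x / 2 ≤ ν.real O * (1 - Real.exp (-x)) := by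
      rcases le_total 0 q with hq0 | hq0
      · nlinarith
      · have : 0 ≤ ν.real O * (1 - Real.exp (-x)) := mul_nonneg measureReal_nonneg (by linarith)
        nlinarith
    calc Real.exp (q * x / 2) * (1 - ν.real O * (1 - Real.exp (-x)))
        ≤ Real.exp (q * x / 2) * Real.exp (-(q * x / 2)) := by
          refine mul_le_mul_of_nonneg_left ?_ (Real.exp_pos _).le
          linarith [Real.add_one_le_exp (-(q * x / 2))]
      _ = 1 := by rw [← Real.exp_add, add_neg_cancel, Real.exp_zero]
  · simp only [h]
    exact ((integrable_const _).sub hi).const_mul _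
  · exact ae_of_all _ fun z => (Real.exp_pos _).le

end ExponentialBounds

/-! ### Confidence, exploration and excess in a single round -/

section Sampling

open Matrix
open scoped ENNReal

variable {Ω : Type*} {d N : ℕ}

/-- The event that the confidence ellipsoid of round `t`, scaled by `κ v_t`, contains `μ`. -/
def confident (κ : ℝ) (v : ℕ → ℝ) (μ : Vec d) (b : ℕ → Fin N → Ω → Vec d)
    (r : ℕ → Fin N → Ω → ℝ) (a : ℕ → Ω → Fin N) (t : ℕ) : Set Ω :=
  {ω | √(selfNormSq μ b r a t ω) + 1 ≤ κ * v t}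

/-- The least squared width of the unsaturated arms of round `t`, scaled by `g²` and truncated. -/
def exploration (g : ℝ) (μ : Vec d) (b : ℕ → Fin N → Ω → Vec d) (a : ℕ → Ω → Fin N) (t : ℕ)
    (ω : Ω) : ℝ :=
  unsaturatedWidthSq g (fun i => inner ℝ (b t i ω) μ) (fun i => width b a t i ω)

/-- The amount by which the gap of the arm played, measured in units of widths, exceeds `2 g`. -/
def excess (g : ℝ) (μ : Vec d) (b : ℕ → Fin N → Ω → Vec d) (a : ℕ → Ω → Fin N) (t : ℕ)
    (ω : Ω) : ℝ :=
  max 0 (gap μ b t (a t ω) ω /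
    (√(exploration g μ b a t ω) / g + width b a t (a t ω) ω) - 2 * g)

/-- The covariance matrix of the sample of round `t`. -/
def sampleCov (v : ℕ → ℝ) (b : ℕ → Fin N → Ω → Vec d) (a : ℕ → Ω → Fin N) (t : ℕ) (ω : Ω) :
    Matrix (Fin d) (Fin d) ℝ :=
  (v t) ^ 2 • (designMatrix b a t ω)⁻¹

/-- The largest squared standardized deviation of a sample in round `t`. -/
def sampleDevSq (v : ℕ → ℝ) (b : ℕ → Fin N → Ω → Vec d) (r : ℕ → Fin N → Ω → ℝ)
    (a : ℕ → Ω → Fin N) (t : ℕ) (z : Ω × Vec d) : ℝ :=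
  maxDevSq (fun i => b t i z.1) (estimate b r a t z.1) (sampleCov v b a t z.1) z.2

variable {R κ g : ℝ} {μ : Vec d} {v : ℕ → ℝ} {b : ℕ → Fin N → Ω → Vec d}
  {r : ℕ → Fin N → Ω → ℝ} {a : ℕ → Ω → Fin N} {s : ℕ → Ω → Vec d} {t : ℕ}

lemma posSemidef_sampleCov (ω : Ω) : (sampleCov v b a t ω).PosSemidef :=
  (posDef_designMatrix_inv t ω).posSemidef.smul (sq_nonneg _)

lemma dotProduct_sampleCov (i : Fin N) (ω : Ω) :
    (b t i ω).ofLp ⬝ᵥ sampleCov v b a t ω *ᵥ (b t i ω).ofLp = (v t * width b a t i ω) ^ 2 := by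
  rw [sampleCov, smul_mulVec, dotProduct_smul, smul_eq_mul, mul_pow, sq_width]

lemma maxDevSq_nonneg (b : Fin N → Vec d) (y : Vec d) {S : Matrix (Fin d) (Fin d) ℝ}
    (hS : S.PosSemidef) (x : Vec d) : 0 ≤ maxDevSq b y S x :=
  Real.iSup_nonneg fun i => div_nonneg (sq_nonneg _)
    (by simpa using hS.dotProduct_mulVec_nonneg (b i).ofLp)

lemma sampleDevSq_nonneg (z : Ω × Vec d) : 0 ≤ sampleDevSq v b r a t z :=
  maxDevSq_nonneg _ _ (posSemidef_sampleCov _) _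

/-- Covers the arms for which the quotient in `maxDevSq` has zero denominator and carries no
information. -/
lemma eq_zero_of_width_eq_zero {i : Fin N} {ω : Ω} (h : width b a t i ω = 0) : b t i ω = 0 := by
  by_contra hne
  have h1 : (b t i ω).ofLp ≠ 0 := fun h2 => hne (by ext j; simp [h2])
  have h2 := (posDef_designMatrix_inv (b := b) (a := a) t ω).dotProduct_mulVec_pos h1
  have h3 := sq_width (b := b) (a := a) t i ω
  rw [h] at h3
  simp only [star_trivial] at h2
  linarith

lemma abs_inner_sub_estimate_le (hv : 0 < v t) (i : Fin N) (ω : Ω) (x : Vec d) :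
    |inner ℝ (b t i ω) x - inner ℝ (b t i ω) (estimate b r a t ω)| ≤
      √(sampleDevSq v b r a t (ω, x)) * v t * width b a t i ω := by
  rcases (width_nonneg (b := b) (a := a) t i ω).eq_or_lt with h | h
  · rw [eq_zero_of_width_eq_zero h.symm, ← h]
    simp
  · have h1 : (inner ℝ (b t i ω) x - inner ℝ (b t i ω) (estimate b r a t ω)) ^ 2 /
        (v t * width b a t i ω) ^ 2 ≤ sampleDevSq v b r a t (ω, x) := by
      rw [← dotProduct_sampleCov]
      exact le_ciSup (f := fun i =>
        (inner ℝ (b t i ω) x - inner ℝ (b t i ω) (estimate b r a t ω)) ^ 2 /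
          ((b t i ω).ofLp ⬝ᵥ sampleCov v b a t ω *ᵥ (b t i ω).ofLp)) (Set.finite_range _).bddAbove i
    have h2 : 0 < v t * width b a t i ω := mul_pos hv h
    rw [div_le_iff₀ (by positivity)] at h1
    have h3 := Real.abs_le_sqrt h1
    rwa [Real.sqrt_mul (sampleDevSq_nonneg _), Real.sqrt_sq h2.le, ← mul_assoc] at h3

lemma abs_inner_estimate_sub_le_of_confident (hμ : ‖μ‖ ≤ 1) {ω : Ω}
    (hω : ω ∈ confident κ v μ b r a t) (i : Fin N) :
    |inner ℝ (b t i ω) (estimate b r a t ω) - inner ℝ (b t i ω) μ| ≤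
      κ * v t * width b a t i ω := by
  refine (abs_inner_estimate_sub_le hμ t i ω).trans ?_
  rw [mul_comm]
  exact mul_le_mul_of_nonneg_right hω (width_nonneg t i ω)

lemma abs_inner_sub_le_of_confident (hμ : ‖μ‖ ≤ 1) (hv : 0 < v t) {ω : Ω}
    (hω : ω ∈ confident κ v μ b r a t) (i : Fin N) (x : Vec d) :
    |inner ℝ (b t i ω) x - inner ℝ (b t i ω) μ| ≤
      (√(sampleDevSq v b r a t (ω, x)) + κ) * v t * width b a t i ω := by
  have h1 := abs_inner_sub_estimate_le (b := b) (r := r) (a := a) hv i ω x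
  have h2 := abs_inner_estimate_sub_le_of_confident hμ hω i
  have h3 := abs_sub_le (inner ℝ (b t i ω) x) (inner ℝ (b t i ω) (estimate b r a t ω))
    (inner ℝ (b t i ω) μ)
  calc _ ≤ _ := h3
    _ ≤ _ := add_le_add h1 h2
    _ = _ := by ring

lemma gap_le_mul_of_confident [NeZero N] (hμ : ‖μ‖ ≤ 1) (hv : 0 < v t) (hg : 0 < g)
    (hκ : 0 ≤ κ) (hκg : κ * v t ≤ g) {ω : Ω} (hω : ω ∈ confident κ v μ b r a t) {x : Vec d}
    (hmax : ∀ i, inner ℝ (b t i ω) x ≤ inner ℝ (b t (a t ω) ω) x)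
    (hgap : gap μ b t (a t ω) ω ≤ 1) :
    gap μ b t (a t ω) ω ≤ (2 * g + √(sampleDevSq v b r a t (ω, x)) * v t) *
      (√(exploration g μ b a t ω) / g + width b a t (a t ω) ω) := by
  have h := gap_le_of_argmax (g := g) (c := (√(sampleDevSq v b r a t (ω, x)) + κ) * v t) hg
    (by positivity) (fun i => width_nonneg (b := b) (a := a) t i ω)
    (abs_inner_sub_le_of_confident hμ hv hω · x) hmax hgap
  refine h.trans (mul_le_mul_of_nonneg_right ?_ ?_)
  · linarith
  · have := width_nonneg (b := b) (a := a) t (a t ω) ω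
    positivity

lemma excess_nonneg (ω : Ω) : 0 ≤ excess g μ b a t ω := le_max_left _ _

/-- `excess` does not mention the sample, so it is measurable one round later although samples are
not part of the history; here it is bounded through the sample. -/
lemma sq_excess_le_of_confident [NeZero N] (hμ : ‖μ‖ ≤ 1) (hv : 0 < v t) (hg : 0 < g)
    (hκ : 0 ≤ κ) (hκg : κ * v t ≤ g) {ω : Ω} (hω : ω ∈ confident κ v μ b r a t) {x : Vec d}
    (hmax : ∀ i, inner ℝ (b t i ω) x ≤ inner ℝ (b t (a t ω) ω) x)
    (hgap : gap μ b t (a t ω) ω ≤ 1) :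
    excess g μ b a t ω ^ 2 ≤ sampleDevSq v b r a t (ω, x) * v t ^ 2 := by
  have h := gap_le_mul_of_confident hμ hv hg hκ hκg hω hmax hgap
  have hw := width_nonneg (b := b) (a := a) t (a t ω) ω
  have h0 : 0 ≤ √(sampleDevSq v b r a t (ω, x)) * v t := by positivity
  have h1 : excess g μ b a t ω ≤ √(sampleDevSq v b r a t (ω, x)) * v t := by
    refine max_le h0 ?_
    have := div_le_of_le_mul₀ (by positivity) (by positivity) h
    linarith
  calc excess g μ b a t ω ^ 2 ≤ (√(sampleDevSq v b r a t (ω, x)) * v t) ^ 2 :=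
        pow_le_pow_left₀ (excess_nonneg ω) h1 2
    _ = _ := by rw [mul_pow, Real.sq_sqrt (sampleDevSq_nonneg _)]

/-- The gap of the arm played, in terms of `excess`. -/
lemma gap_le_excess_mul [NeZero N] (hμ : ‖μ‖ ≤ 1) (hv : 0 < v t) (hg : 0 < g)
    (hκ : 0 ≤ κ) (hκg : κ * v t ≤ g) {ω : Ω} (hω : ω ∈ confident κ v μ b r a t) {x : Vec d}
    (hmax : ∀ i, inner ℝ (b t i ω) x ≤ inner ℝ (b t (a t ω) ω) x)
    (hgap : gap μ b t (a t ω) ω ≤ 1) :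
    gap μ b t (a t ω) ω ≤ (2 * g + excess g μ b a t ω) *
      (√(exploration g μ b a t ω) / g + width b a t (a t ω) ω) := by
  have h := gap_le_mul_of_confident hμ hv hg hκ hκg hω hmax hgap
  have hw := width_nonneg (b := b) (a := a) t (a t ω) ω
  have h0 : 0 ≤ √(exploration g μ b a t ω) / g + width b a t (a t ω) ω := by positivity
  rcases h0.eq_or_lt with h1 | h1
  · rw [← h1, mul_zero] at h
    rwa [← h1, mul_zero]
  · rw [← div_le_iff₀ h1]
    have := le_max_right 0 (gap μ b t (a t ω) ω /
      (√(exploration g μ b a t ω) / g + width b a t (a t ω) ω) - 2 * g)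
    change _ ≤ excess g μ b a t ω at this
    linarith

section Measurable

variable {mΩ : MeasurableSpace Ω}

lemma HistoryMeasurable.confident (h : HistoryMeasurable b r a t) :
    MeasurableSet (confident κ v μ b r a t) :=
  measurableSet_le (h.selfNormSq.sqrt.add_const 1) measurable_const

lemma HistoryMeasurable.exploration (h : HistoryMeasurable b r a t)
    (hb : ∀ i, Measurable (b t i)) : Measurable (exploration g μ b a t) := by
  unfold LinBandit.exploration unsaturatedWidthSq
  refine Measurable.iInf fun i => Measurable.ite ?_ ?_ measurable_const
  · exact measurableSet_le (measurable_gap hb i) ((h.width (hb i)).const_mul g)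
  · exact (((h.width (hb i)).const_mul g).pow_const 2).min measurable_const

lemma HistoryMeasurable.playedWidth (h : HistoryMeasurable b r a t)
    (hb : ∀ i, Measurable (b t i)) (ha : Measurable (a t)) :
    Measurable fun ω => LinBandit.width b a t (a t ω) ω :=
  measurable_apply_index (fun i => h.width (hb i)) ha

lemma HistoryMeasurable.excess (h : HistoryMeasurable b r a t)
    (hb : ∀ i, Measurable (b t i)) (ha : Measurable (a t)) :
    Measurable (excess g μ b a t) := by
  refine measurable_const.max (((measurable_apply_index (measurable_gap hb) ha).div ?_).sub_const _)
  exact ((h.exploration hb).sqrt.div_const g).add (h.playedWidth hb ha)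

lemma HistoryMeasurable.sampleDevSq (h : HistoryMeasurable b r a t)
    (hb : ∀ i, Measurable (b t i)) : Measurable (sampleDevSq v b r a t) := by
  unfold LinBandit.sampleDevSq maxDevSq
  refine Measurable.iSup fun i => ?_
  simp only [dotProduct_sampleCov]
  have h1 : Measurable fun z : Ω × Vec d => b t i z.1 := (hb i).comp measurable_fst
  have h2 : Measurable fun z : Ω × Vec d => LinBandit.estimate b r a t z.1 :=
    h.estimate.comp measurable_fst
  have h3 : Measurable fun z : Ω × Vec d => LinBandit.width b a t i z.1 :=
    (h.width (hb i)).comp measurable_fst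
  exact (((h1.inner measurable_snd).sub (h1.inner h2)).pow_const 2).div
    ((h3.const_mul _).pow_const 2)

end Measurable

end Sampling

/-! ### Supermartingale increments driven by the Gaussian sample -/

section Increments

open Matrix
open scoped ENNReal

variable {Ω : Type*} {d N : ℕ} {mΩ : MeasurableSpace Ω} {P : Measure Ω} [IsProbabilityMeasure P]
  {R κ g : ℝ} {μ : Vec d} {v : ℕ → ℝ} {b : ℕ → Fin N → Ω → Vec d}
  {r : ℕ → Fin N → Ω → ℝ} {a : ℕ → Ω → Fin N} {s : ℕ → Ω → Vec d} {t : ℕ}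

/-- The conditional law of the sample, for functions of the history, contexts and the sample. -/
lemma lintegral_sample (hB : IsLinearBandit P R μ b r a) (hT : IsThompsonSampling P v b r a s)
    (ht : 1 ≤ t) {F : Ω × Vec d → ℝ≥0∞}
    (hF : @Measurable _ _ ((info b r a t).prod inferInstance) _ F) :
    ∫⁻ ω, F (ω, s t ω) ∂P =
      ∫⁻ ω, ∫⁻ x, F (ω, x) ∂(multivariateGaussian (estimate b r a t ω) (sampleCov v b a t ω)) ∂P := by
  have hX : @Measurable Ω Ω mΩ (info b r a t) id := measurable_id'' (hB.info_le ht)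
  refine @lintegral_comp_eq_lintegral_condLaw Ω Ω (Vec d) mΩ (info b r a t) P _ _ _ _ id hX (s t)
    (hT.measurable_sample t ht)
    (fun ω => multivariateGaussian (estimate b r a t ω) (sampleCov v b a t ω))
    (fun ω => inferInstance) (fun A hA => ?_) F hF
  rw [MeasurableSpace.comap_id]
  exact hT.sample_law t ht A hA

/-- Reduces a conditional mean to a Gaussian integral for each fixed history: the tie-breaking is
removed by passing to a majorant `F` of the sample alone. -/
lemma condMeanLEOne_of_sample (hB : IsLinearBandit P R μ b r a)
    (hT : IsThompsonSampling P v b r a s) (ht : 1 ≤ t) {f : Ω → ℝ≥0∞} {F : Ω × Vec d → ℝ≥0∞}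
    (hF : @Measurable _ _ ((info b r a t).prod inferInstance) _ F)
    (hle : ∀ ω, f ω ≤ F (ω, s t ω))
    (hmean : ∀ ω, ∫⁻ x, F (ω, x)
      ∂(multivariateGaussian (estimate b r a t ω) (sampleCov v b a t ω)) ≤ 1) :
    CondMeanLEOne P (info b r a t) f := by
  intro ψ hψ
  have hψ1 : @Measurable _ _ ((info b r a t).prod (inferInstance : MeasurableSpace (Vec d)))
      _ fun z : Ω × Vec d => ψ z.1 := hψ.comp measurable_fst
  have hsec : ∀ ω, Measurable fun x => F (ω, x) := fun ω => hF.comp measurable_prodMk_left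
  calc ∫⁻ ω, ψ ω * f ω ∂P ≤ ∫⁻ ω, ψ ω * F (ω, s t ω) ∂P :=
        lintegral_mono fun ω => mul_le_mul_right (hle ω) _
    _ = ∫⁻ ω, ∫⁻ x, ψ ω * F (ω, x)
          ∂(multivariateGaussian (estimate b r a t ω) (sampleCov v b a t ω)) ∂P :=
        lintegral_sample hB hT ht (F := fun z => ψ z.1 * F z) (hψ1.mul hF)
    _ ≤ ∫⁻ ω, ψ ω ∂P := by
        refine lintegral_mono fun ω => ?_
        rw [lintegral_const_mul _ (hsec ω)]
        exact mul_le_of_le_one_right' (hmean ω)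

/-- The logarithmic increment that controls the sum of squares of `excess`. -/
def excessIncrement (κ g c : ℝ) (v : ℕ → ℝ) (μ : Vec d) (b : ℕ → Fin N → Ω → Vec d)
    (r : ℕ → Fin N → Ω → ℝ) (a : ℕ → Ω → Fin N) (t : ℕ) (ω : Ω) : ℝ :=
  (confident κ v μ b r a t).indicator (fun ω => excess g μ b a t ω ^ 2 / (4 * v t ^ 2)) ω - c

/-- The logarithmic increment that compares `exploration` with the widths of the arms played. -/
def explorationIncrement (κ g q : ℝ) (v : ℕ → ℝ) (μ : Vec d) (b : ℕ → Fin N → Ω → Vec d)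
    (r : ℕ → Fin N → Ω → ℝ) (a : ℕ → Ω → Fin N) (t : ℕ) (ω : Ω) : ℝ :=
  (confident κ v μ b r a t).indicator (fun ω => q * exploration g μ b a t ω / 2 -
    min ((g * width b a t (a t ω) ω) ^ 2) 1) ω

lemma measurable_arm_info_succ (ht : 1 ≤ t) : Measurable[info b r a (t + 1)] (a t) :=
  Measurable.of_comap_le ((le_sup_left.trans le_sup_left).trans
    ((le_history (Finset.mem_Ico.mpr ⟨ht, Nat.lt_succ_self t⟩)).trans le_sup_left))

lemma HistoryMeasurable.mono {m m' : MeasurableSpace Ω} (hle : m ≤ m')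
    (h : @HistoryMeasurable Ω m d N b r a t) : @HistoryMeasurable Ω m' d N b r a t :=
  @HistoryMeasurable.mk Ω m' d N b r a t
    (fun τ hτ => (@HistoryMeasurable.arm Ω m d N b r a t h τ hτ).mono hle le_rfl)
    (fun τ hτ => (@HistoryMeasurable.reward Ω m d N b r a t h τ hτ).mono hle le_rfl)
    (fun τ hτ i => (@HistoryMeasurable.context Ω m d N b r a t h τ hτ i).mono hle le_rfl)

lemma historyMeasurable_info_succ (ht : 1 ≤ t) :
    @HistoryMeasurable Ω (info b r a (t + 1)) d N b r a t :=
  historyMeasurable_info.mono (info_le_info_succ ht)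

lemma measurable_context_info_succ (ht : 1 ≤ t) (i : Fin N) :
    Measurable[info b r a (t + 1)] (b t i) :=
  (measurable_context_info i).mono (info_le_info_succ ht) le_rfl

lemma measurable_excessIncrement (ht : 1 ≤ t) (c : ℝ) :
    Measurable[info b r a (t + 1)] (excessIncrement κ g c v μ b r a t) := by
  have h := historyMeasurable_info_succ (b := b) (r := r) (a := a) ht
  exact Measurable.sub_const (Measurable.indicator (((h.excess (measurable_context_info_succ ht)
    (measurable_arm_info_succ ht)).pow_const 2).div_const _) h.confident) c

lemma measurable_explorationIncrement (ht : 1 ≤ t) (q : ℝ) :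
    Measurable[info b r a (t + 1)] (explorationIncrement κ g q v μ b r a t) := by
  have h := historyMeasurable_info_succ (b := b) (r := r) (a := a) ht
  refine Measurable.indicator (Measurable.sub ?_ ?_) h.confident
  · exact ((h.exploration (measurable_context_info_succ ht)).const_mul q).div_const 2
  · exact (((h.playedWidth (measurable_context_info_succ ht)
      (measurable_arm_info_succ ht)).const_mul g).pow_const 2).min measurable_const

lemma condMeanLEOne_exp_excessIncrement (hN : 2 ≤ N) (hB : IsLinearBandit P R μ b r a)
    (hT : IsThompsonSampling P v b r a s) (ht : 1 ≤ t) (hv : 0 < v t) (hg : 0 < g) (hκ : 0 ≤ κ)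
    (hκg : κ * v t ≤ g) :
    CondMeanLEOne P (info b r a t) (fun ω => ENNReal.ofReal (Real.exp
      (excessIncrement κ g (3 / 2 * min (d : ℝ) (Real.log N)) v μ b r a t ω))) := by
  have : NeZero N := ⟨by omega⟩
  have hist := historyMeasurable_info (b := b) (r := r) (a := a) (t := t)
  have hdev := hist.sampleDevSq (v := v) measurable_context_info
  refine condMeanLEOne_of_sample hB hT ht (F := fun z => ENNReal.ofReal (Real.exp
    (-(3 / 2 * min (d : ℝ) (Real.log N)))) * ENNReal.ofReal (Real.exp
      (sampleDevSq v b r a t z / 4))) ?_ (fun ω => ?_) fun ω => ?_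
  · exact (Real.measurable_exp.comp (hdev.div_const 4)).ennreal_ofReal.const_mul _
  · rw [← ENNReal.ofReal_mul (Real.exp_pos _).le, ← Real.exp_add]
    refine ENNReal.ofReal_le_ofReal (Real.exp_le_exp.mpr ?_)
    have hind : (confident κ v μ b r a t).indicator
        (fun ω => excess g μ b a t ω ^ 2 / (4 * v t ^ 2)) ω ≤
        sampleDevSq v b r a t (ω, s t ω) / 4 := by
      have h0 := sampleDevSq_nonneg (v := v) (b := b) (r := r) (a := a) (t := t) (ω, s t ω)
      refine Set.indicator_apply_le' (fun hω => ?_) fun _ => by positivity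
      have h := sq_excess_le_of_confident hB.norm_param_le hv hg hκ hκg hω
        (hT.arm_argmax t ht ω) (hB.gap_le t ht _ ω)
      rw [div_le_div_iff₀ (by positivity) (by norm_num)]
      linarith
    unfold excessIncrement
    linarith
  · have hm := measurable_maxDevSq (fun i => b t i ω) (estimate b r a t ω) (sampleCov v b a t ω)
    have hm' : Measurable fun x => ENNReal.ofReal
        (Real.exp (sampleDevSq v b r a t (ω, x) / 4)) :=
      (Real.measurable_exp.comp (hm.div_const 4)).ennreal_ofReal
    rw [lintegral_const_mul _ hm']
    refine (mul_le_mul_right (lintegral_exp_maxDevSq_le hN (fun i => b t i ω)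
      (estimate b r a t ω) (posSemidef_sampleCov ω)) _).trans_eq ?_
    rw [← ENNReal.ofReal_mul (Real.exp_pos _).le, ← Real.exp_add, neg_add_cancel, Real.exp_zero,
      ENNReal.ofReal_one]

/-- The samples in round `t` that are optimistic and do not deviate much from the estimate. -/
def optimistic (M : ℝ) (v : ℕ → ℝ) (μ : Vec d) (b : ℕ → Fin N → Ω → Vec d)
    (r : ℕ → Fin N → Ω → ℝ) (a : ℕ → Ω → Fin N) (t : ℕ) : Set (Ω × Vec d) :=
  {z | (⨆ j, inner ℝ (b t j z.1) μ) ≤ ⨆ j, inner ℝ (b t j z.1) z.2} ∩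
    {z | sampleDevSq v b r a t z ≤ M}

/-- Markov's inequality for the exponential moment of the deviation. -/
lemma measure_sampleDevSq_gt_le (hN : 2 ≤ N) (M : ℝ) (ω : Ω) :
    multivariateGaussian (estimate b r a t ω) (sampleCov v b a t ω)
        {x | M < sampleDevSq v b r a t (ω, x)} ≤
      ENNReal.ofReal (Real.exp (3 / 2 * min (d : ℝ) (Real.log N) - M / 4)) := by
  have hm := measurable_maxDevSq (fun i => b t i ω) (estimate b r a t ω) (sampleCov v b a t ω)
  have h := mul_meas_ge_le_lintegral₀
    (μ := multivariateGaussian (estimate b r a t ω) (sampleCov v b a t ω))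
    (f := fun x => ENNReal.ofReal (Real.exp (sampleDevSq v b r a t (ω, x) / 4)))
    ((Real.measurable_exp.comp (hm.div_const 4)).ennreal_ofReal).aemeasurable
    (ENNReal.ofReal (Real.exp (M / 4)))
  have h1 := h.trans (lintegral_exp_maxDevSq_le hN (fun i => b t i ω)
      (estimate b r a t ω) (posSemidef_sampleCov ω))
  rw [sub_eq_neg_add, Real.exp_add, ENNReal.ofReal_mul (Real.exp_pos _).le]
  refine le_trans ?_ (mul_le_mul_right h1 _)
  rw [← mul_assoc, ← ENNReal.ofReal_mul (Real.exp_pos _).le, ← Real.exp_add, neg_add_cancel,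
    Real.exp_zero, ENNReal.ofReal_one, one_mul]
  refine measure_mono fun x hx => ?_
  have hx' : M < sampleDevSq v b r a t (ω, x) := hx
  exact ENNReal.ofReal_le_ofReal (Real.exp_le_exp.mpr (by linarith))

lemma HistoryMeasurable.optimistic {m : MeasurableSpace Ω} (h : HistoryMeasurable b r a t)
    (hb : ∀ i, Measurable (b t i)) (M : ℝ) : MeasurableSet (optimistic M v μ b r a t) := by
  refine (measurableSet_le (Measurable.iSup fun j => ?_) (Measurable.iSup fun j => ?_)).inter
    (measurableSet_le (h.sampleDevSq hb) measurable_const)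
  · exact ((hb j).comp measurable_fst).inner_const
  · exact ((hb j).comp measurable_fst).inner measurable_snd

/-- Anti-concentration in the direction of an optimal arm gives optimism with probability at least
2q; discarding samples with large deviation loses at most q. -/
lemma le_measureReal_optimistic (hN : 2 ≤ N) (hμ : ‖μ‖ ≤ 1) (hv : 0 < v t) {M q : ℝ}
    (hM : Real.exp (3 / 2 * min (d : ℝ) (Real.log N) - M / 4) ≤ q)
    (hq : 2 * q ≤ (gaussianReal 0 1).real (Set.Ici κ)) {ω : Ω}
    (hω : ω ∈ confident κ v μ b r a t) :
    q ≤ (multivariateGaussian (estimate b r a t ω) (sampleCov v b a t ω)).real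
      {x | (ω, x) ∈ optimistic M v μ b r a t} := by
  have : NeZero N := ⟨by omega⟩
  set ν := multivariateGaussian (estimate b r a t ω) (sampleCov v b a t ω)
  obtain ⟨j, hj⟩ := exists_eq_ciSup_of_finite (f := fun j => (inner ℝ (b t j ω) μ : ℝ))
  have h1 := gaussianReal_Ici_le_multivariateGaussian (posSemidef_sampleCov (v := v) (b := b)
    (a := a) (t := t) ω) (b t j ω) (estimate b r a t ω) (κ := κ) (c := inner ℝ (b t j ω) μ) (by
      rw [dotProduct_sampleCov, Real.sqrt_sq (mul_nonneg hv.le (width_nonneg t j ω))]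
      have h2 := abs_inner_estimate_sub_le_of_confident hμ hω j
      have h3 := neg_abs_le (inner ℝ (b t j ω) (estimate b r a t ω) - inner ℝ (b t j ω) μ)
      linarith)
  have h2 : {x : Vec d | inner ℝ (b t j ω) μ ≤ inner ℝ (b t j ω) x} ⊆
      {x | (ω, x) ∈ optimistic M v μ b r a t} ∪ {x | M < sampleDevSq v b r a t (ω, x)} := by
    intro x hx
    rcases le_or_gt (sampleDevSq v b r a t (ω, x)) M with h | h
    · refine Or.inl ⟨?_, h⟩
      change (⨆ j, inner ℝ (b t j ω) μ) ≤ ⨆ j, inner ℝ (b t j ω) x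
      rw [← hj]
      exact le_trans hx (le_ciSup (f := fun j => (inner ℝ (b t j ω) x : ℝ))
        (Set.finite_range _).bddAbove j)
    · exact Or.inr h
  have h3 := measure_sampleDevSq_gt_le (v := v) (b := b) (r := r) (a := a) (t := t) hN M ω
  have h4 : (gaussianReal 0 1).real (Set.Ici κ) ≤
      ν.real {x : Vec d | inner ℝ (b t j ω) μ ≤ inner ℝ (b t j ω) x} :=
    ENNReal.toReal_mono (measure_ne_top _ _) h1
  have h5 := (measureReal_mono (μ := ν) h2).trans (measureReal_union_le _ _)
  have h6 : ν.real {x | M < sampleDevSq v b r a t (ω, x)} ≤ q := by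
    refine le_trans ?_ hM
    exact ENNReal.toReal_le_of_le_ofReal (Real.exp_pos _).le h3
  linarith

/-- On an optimistic sample of small deviation the played arm is unsaturated, so its truncated
squared width dominates `exploration`; on other samples zero is a lower bound. The confident event
is known given `info`, so the indicator makes the increment vanish off it. -/
lemma condMeanLEOne_exp_explorationIncrement (hN : 2 ≤ N) (hB : IsLinearBandit P R μ b r a)
    (hT : IsThompsonSampling P v b r a s) (ht : 1 ≤ t) (hv : 0 < v t) {M q : ℝ}
    (hMg : (√M + κ) * v t ≤ g)
    (hM : Real.exp (3 / 2 * min (d : ℝ) (Real.log N) - M / 4) ≤ q)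
    (hq : 2 * q ≤ (gaussianReal 0 1).real (Set.Ici κ)) :
    CondMeanLEOne P (info b r a t) (fun ω => ENNReal.ofReal (Real.exp
      (explorationIncrement κ g q v μ b r a t ω))) := by
  have : NeZero N := ⟨by omega⟩
  have hist := historyMeasurable_info (b := b) (r := r) (a := a) (t := t)
  have hopt := hist.optimistic (v := v) (μ := μ) measurable_context_info M
  have hX := hist.exploration (g := g) (μ := μ) measurable_context_info
  have hX1 : @Measurable _ _ ((info b r a t).prod (inferInstance : MeasurableSpace (Vec d)))
      _ fun z : Ω × Vec d => exploration g μ b a t z.1 := hX.comp measurable_fst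
  have hconf : @MeasurableSet _ ((info b r a t).prod (inferInstance : MeasurableSpace (Vec d)))
      (Prod.fst ⁻¹' confident κ v μ b r a t) := measurable_fst (hist.confident (κ := κ))
  refine condMeanLEOne_of_sample hB hT ht (F := fun z => ENNReal.ofReal (Real.exp
    ((Prod.fst ⁻¹' confident κ v μ b r a t).indicator (fun z => q * exploration g μ b a t z.1 / 2 -
      (optimistic M v μ b r a t).indicator (fun z => exploration g μ b a t z.1) z) z)))
    ?_ (fun ω => ?_) fun ω => ?_
  · exact (Real.measurable_exp.comp (Measurable.indicator (((hX1.const_mul q).div_const 2).sub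
      (hX1.indicator hopt)) hconf)).ennreal_ofReal
  · refine ENNReal.ofReal_le_ofReal (Real.exp_le_exp.mpr ?_)
    unfold explorationIncrement
    by_cases hω : ω ∈ confident κ v μ b r a t
    · rw [Set.indicator_of_mem hω, Set.indicator_of_mem
        (show (ω, s t ω) ∈ Prod.fst ⁻¹' confident κ v μ b r a t from hω)]
      refine sub_le_sub_left (Set.indicator_apply_le' (fun hz => ?_) fun _ =>
        le_min (sq_nonneg _) zero_le_one) _
      have hU : √(sampleDevSq v b r a t (ω, s t ω)) ≤ √M := Real.sqrt_le_sqrt hz.2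
      refine unsaturatedWidthSq_le_of_optimistic (y := fun i => inner ℝ (b t i ω) (s t ω))
        (c := (√(sampleDevSq v b r a t (ω, s t ω)) + κ) * v t) (width_nonneg t _ ω) ?_
        (abs_inner_sub_le_of_confident hB.norm_param_le hv hω _ _) ?_
      · exact le_trans (mul_le_mul_of_nonneg_right (by linarith) hv.le) hMg
      · exact le_trans hz.1 (ciSup_le fun j => hT.arm_argmax t ht ω j)
    · rw [Set.indicator_of_notMem hω, Set.indicator_of_notMem
        (show (ω, s t ω) ∉ Prod.fst ⁻¹' confident κ v μ b r a t from hω)]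
  · by_cases hω : ω ∈ confident κ v μ b r a t
    · have hsec : MeasurableSet {x | (ω, x) ∈ optimistic M v μ b r a t} :=
        hopt.preimage measurable_prodMk_left
      have h := lintegral_exp_sub_indicator_le_one hsec
        (le_measureReal_optimistic hN hB.norm_param_le hv hM hq hω)
        (unsaturatedWidthSq_nonneg (g := g) (θ := fun i => inner ℝ (b t i ω) μ)
          (s := fun i => width b a t i ω)) unsaturatedWidthSq_le_one
      refine le_trans (le_of_eq (lintegral_congr fun x => ?_)) h
      rw [Set.indicator_of_mem (show (ω, x) ∈ Prod.fst ⁻¹' confident κ v μ b r a t from hω)]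
      rfl
    · refine le_of_eq ?_
      have h1 : ∀ x : Vec d, (Prod.fst ⁻¹' confident κ v μ b r a t).indicator
          (fun z : Ω × Vec d => q * exploration g μ b a t z.1 / 2 -
            (optimistic M v μ b r a t).indicator (fun z => exploration g μ b a t z.1) z) (ω, x) = 0 :=
        fun x => Set.indicator_of_notMem
          (show (ω, x) ∉ Prod.fst ⁻¹' confident κ v μ b r a t from hω) _
      simp [h1]

end Increments

/-! ### Elementary estimates for the scale and the final bound -/

section Bounds

open scoped ENNReal

lemma half_le_log {x : ℝ} (hx : 2 ≤ x) : 1 / 2 ≤ Real.log x :=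
  le_trans (by linarith [Real.log_two_gt_d9]) (Real.log_le_log two_pos hx)

lemma log_three_le_two_mul_log {x : ℝ} (hx : 2 ≤ x) : Real.log 3 ≤ 2 * Real.log x := by
  have h : Real.log (x ^ 2) = 2 * Real.log x := by rw [Real.log_pow]; norm_num
  rw [← h]
  exact Real.log_le_log (by norm_num) (by nlinarith)

/-- Since d^{3/2} = d√d, the two bounds differ only in the factor √d or √(ln N). -/
lemma min_dimBound_armBound (d N T : ℕ) (δ : ℝ) :
    min (dimBound d T δ) (armBound d N T δ) =
      d * √(min (d : ℝ) (Real.log N)) * √T * (Real.log T + √(Real.log T * Real.log (1 / δ))) := by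
  have h0 : 0 ≤ Real.log T + √(Real.log T * Real.log (1 / δ)) :=
    add_nonneg (Real.log_natCast_nonneg T) (Real.sqrt_nonneg _)
  have hd : (d : ℝ) ^ (3 / 2 : ℝ) = d * √d := by
    rcases Nat.eq_zero_or_pos d with rfl | hd
    · simp
    · have : (0 : ℝ) < d := by exact_mod_cast hd
      rw [show (3 / 2 : ℝ) = 1 + 1 / 2 by norm_num, Real.rpow_add this, Real.rpow_one,
        ← Real.sqrt_eq_rpow]
  have hmin : √(min (d : ℝ) (Real.log N)) = min √(d : ℝ) √(Real.log N) :=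
    Real.sqrt_monotone.map_min
  rw [dimBound, armBound, hd, hmin, Real.sqrt_mul (Nat.cast_nonneg T),
    mul_min_of_nonneg _ _ (Nat.cast_nonneg d), min_mul_of_nonneg _ _ (Real.sqrt_nonneg _),
    min_mul_of_nonneg _ _ h0]
  congr 1
  ring

lemma half_le_min_dim_log {d N : ℕ} (hd : 1 ≤ d) (hN : 2 ≤ N) :
    1 / 2 ≤ min (d : ℝ) (Real.log N) := by
  refine le_min ?_ (half_le_log (by exact_mod_cast hN))
  have : (1 : ℝ) ≤ d := by exact_mod_cast hd
  linarith

lemma sqrt_mul_le_two_mul_bound {d N T : ℕ} (hd : 1 ≤ d) (hN : 2 ≤ N) {δ y : ℝ}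
    (hy : y ≤ Real.log T + √(Real.log T * Real.log (1 / δ))) :
    √T * y ≤ 2 * min (dimBound d T δ) (armBound d N T δ) := by
  rw [min_dimBound_armBound]
  have hm : 1 / 2 ≤ √(min (d : ℝ) (Real.log N)) :=
    Real.le_sqrt_of_sq_le (le_trans (by norm_num) (half_le_min_dim_log hd hN))
  have hd' : (1 : ℝ) ≤ d := by exact_mod_cast hd
  have hz : 0 ≤ Real.log T + √(Real.log T * Real.log (1 / δ)) :=
    add_nonneg (Real.log_natCast_nonneg T) (Real.sqrt_nonneg _)
  have hdm : 1 / 2 ≤ d * √(min (d : ℝ) (Real.log N)) := by nlinarith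
  calc √T * y ≤ √T * (Real.log T + √(Real.log T * Real.log (1 / δ))) := by gcongr
    _ = 2 * (1 / 2 * √T * (Real.log T + √(Real.log T * Real.log (1 / δ)))) := by ring
    _ ≤ _ := by gcongr

lemma sqrt_log_mul_log_div_le {T δ : ℝ} (hT : 2 ≤ T) (hδ : 0 < δ) (hδ1 : δ < 1) :
    √(Real.log T * Real.log (T / δ)) ≤ Real.log T + √(Real.log T * Real.log (1 / δ)) := by
  have h1 : Real.log (T / δ) = Real.log T + Real.log (1 / δ) := by
    rw [div_eq_mul_one_div, Real.log_mul (by positivity) (by positivity)]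
  have hlT : 0 ≤ Real.log T := by linarith [half_le_log hT]
  have hl : 0 ≤ Real.log (1 / δ) := Real.log_nonneg (by rw [le_div_iff₀ hδ]; linarith)
  rw [h1, mul_add]
  refine Real.sqrt_le_iff.mpr ⟨by positivity, ?_⟩
  have h2 := Real.sq_sqrt (mul_nonneg hlT hl)
  nlinarith [Real.sqrt_nonneg (Real.log T * Real.log (1 / δ))]

lemma log_div_delta {x δ : ℝ} (hx : 0 < x) (hδ : 0 < δ) :
    Real.log (x / δ) = Real.log x + Real.log (1 / δ) := by
  rw [div_eq_mul_one_div, Real.log_mul hx.ne' (by positivity)]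

lemma log_one_div_nonneg {δ : ℝ} (hδ : 0 < δ) (hδ1 : δ < 1) : 0 ≤ Real.log (1 / δ) :=
  Real.log_nonneg (by rw [le_div_iff₀ hδ]; linarith)

lemma scale_mono {R : ℝ} (hR : 0 < R) (d : ℕ) {δ x y : ℝ} (hδ : 0 < δ) (hx : 0 < x)
    (hxy : x ≤ y) : scale R d δ x ≤ scale R d δ y := by
  unfold scale
  refine mul_le_mul_of_nonneg_left (Real.sqrt_le_sqrt ?_) hR.le
  have := Real.log_le_log (show 0 < x / δ by positivity) (div_le_div_of_nonneg_right hxy hδ.le)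
  have hd : (0 : ℝ) ≤ 9 * d := by positivity
  exact mul_le_mul_of_nonneg_left this hd

lemma two_mul_le_scale {R : ℝ} (hR : 0 < R) {d : ℕ} (hd : 1 ≤ d) {δ x : ℝ} (hδ : 0 < δ)
    (hδ1 : δ < 1) (hx : 2 ≤ x) : 2 * R ≤ scale R d δ x := by
  have hd' : (1 : ℝ) ≤ d := by exact_mod_cast hd
  have h1 := half_le_log hx
  have h2 := log_one_div_nonneg hδ hδ1
  rw [scale, mul_comm, log_div_delta (by linarith) hδ]
  refine mul_le_mul_of_nonneg_left (Real.le_sqrt_of_sq_le ?_) hR.le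
  nlinarith

/-- The self-normalized bound at confidence level `δ / (3 t²)` is at most the scale of round `t`. -/
lemma sqrt_le_scale {R : ℝ} (hR : 0 < R) {d : ℕ} (hd : 1 ≤ d) {δ x y : ℝ} (hδ : 0 < δ)
    (hδ1 : δ < 1) (hx : 2 ≤ x)
    (hy : y ≤ R ^ 2 * (d * Real.log x + 2 * Real.log (1 / (δ / (3 * x ^ 2))))) :
    √y ≤ scale R d δ x := by
  have hd' : (1 : ℝ) ≤ d := by exact_mod_cast hd
  have hx0 : 0 < x := by linarith
  have h1 := half_le_log hx
  have h2 := log_one_div_nonneg hδ hδ1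
  have h3 := log_three_le_two_mul_log hx
  have h4 : Real.log (1 / (δ / (3 * x ^ 2))) =
      Real.log 3 + 2 * Real.log x + Real.log (1 / δ) := by
    rw [one_div_div, log_div_delta (by positivity) hδ, Real.log_mul (by norm_num) (by positivity),
      Real.log_pow]
    norm_num
  -- As ln 3 ≤ 2 ln x, the left side is at most (d + 8) ln x + 2 ln(1/δ); the 9 in `scale` is what
  -- this needs.
  have h5 : d * Real.log x + 2 * Real.log (1 / (δ / (3 * x ^ 2))) ≤
      9 * d * Real.log (x / δ) := by
    rw [h4, log_div_delta hx0 hδ]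
    nlinarith
  calc √y ≤ √(R ^ 2 * (9 * d * Real.log (x / δ))) := Real.sqrt_le_sqrt (hy.trans (by gcongr))
    _ = scale R d δ x := by rw [Real.sqrt_mul (sq_nonneg R), Real.sqrt_sq hR.le, scale]

end Bounds

/-! ### Cauchy–Schwarz over the rounds -/

section Deterministic

open scoped ENNReal

/-- Cauchy–Schwarz applied to the regret decomposition. -/
lemma sum_mul_le_sqrt_mul_sqrt_of_bounds {I : Finset ℕ} {n : ℕ} (hI : I.card ≤ n)
    {g : ℝ} {Y X w : ℕ → ℝ} (hX : ∀ t ∈ I, 0 ≤ X t) :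
    ∑ t ∈ I, (2 * g + Y t) * (√(X t) / g + w t) ≤
      √(8 * g ^ 2 * n + 2 * ∑ t ∈ I, Y t ^ 2) *
        √(2 * (∑ t ∈ I, X t) / g ^ 2 + 2 * ∑ t ∈ I, w t ^ 2) := by
  refine (Real.sum_mul_le_sqrt_mul_sqrt I _ _).trans ?_
  have h1 : ∑ t ∈ I, (2 * g + Y t) ^ 2 ≤ 8 * g ^ 2 * n + 2 * ∑ t ∈ I, Y t ^ 2 := by
    calc ∑ t ∈ I, (2 * g + Y t) ^ 2 ≤ ∑ t ∈ I, (8 * g ^ 2 + 2 * Y t ^ 2) :=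
          Finset.sum_le_sum fun t _ => by nlinarith [sq_nonneg (2 * g - Y t)]
      _ = I.card * (8 * g ^ 2) + 2 * ∑ t ∈ I, Y t ^ 2 := by
          rw [Finset.sum_add_distrib, Finset.sum_const, nsmul_eq_mul, Finset.mul_sum]
      _ ≤ _ := by
          have : (I.card : ℝ) ≤ n := by exact_mod_cast hI
          nlinarith [sq_nonneg g]
  have h2 : ∑ t ∈ I, (√(X t) / g + w t) ^ 2 ≤
      2 * (∑ t ∈ I, X t) / g ^ 2 + 2 * ∑ t ∈ I, w t ^ 2 := by
    calc ∑ t ∈ I, (√(X t) / g + w t) ^ 2 ≤ ∑ t ∈ I, (2 / g ^ 2 * X t + 2 * w t ^ 2) := by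
          refine Finset.sum_le_sum fun t ht => ?_
          have h3 : (√(X t) / g) ^ 2 = X t / g ^ 2 := by rw [div_pow, Real.sq_sqrt (hX t ht)]
          have h4 : 2 / g ^ 2 * X t = 2 * (√(X t) / g) ^ 2 := by rw [h3]; ring
          rw [h4]
          nlinarith [sq_nonneg (√(X t) / g - w t)]
      _ = _ := by
          rw [Finset.sum_add_distrib, ← Finset.mul_sum, ← Finset.mul_sum]
          ring
  gcongr

end Deterministic

/-! ### Regret on the good event and the probability of the bad one -/

section Regret

open scoped ENNReal

variable {Ω : Type*} {d N : ℕ} {mΩ : MeasurableSpace Ω} {P : Measure Ω}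
  {R κ g : ℝ} {μ : Vec d} {v : ℕ → ℝ} {b : ℕ → Fin N → Ω → Vec d}
  {r : ℕ → Fin N → Ω → ℝ} {a : ℕ → Ω → Fin N} {s : ℕ → Ω → Vec d} {T : ℕ}

lemma regret_le_horizon (hB : IsLinearBandit P R μ b r a) (T : ℕ) (ω : Ω) :
    regret μ b a T ω ≤ T := by
  have h := Finset.sum_le_card_nsmul (Finset.Icc 1 T) (fun t => gap μ b t (a t ω) ω) 1
    fun t ht => hB.gap_le t (Finset.mem_Icc.mp ht).1 _ ω
  simpa [regret] using h

lemma regret_eq_zero_of_forall_inner_eq (h : ∀ t i j ω, inner ℝ (b t i ω) μ = inner ℝ (b t j ω) μ)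
    (ω : Ω) : regret μ b a T ω = 0 := by
  refine Finset.sum_eq_zero fun t _ => ?_
  have : Nonempty (Fin N) := ⟨a t ω⟩
  rw [gap, funext fun j => h t j (a t ω) ω, ciSup_const, sub_self]

/-- The regret on the event that the confidence ellipsoids contain `μ` and the exponential
supermartingales are not large. -/
lemma regret_le_of_good [NeZero N] (hB : IsLinearBandit P R μ b r a)
    (hT : IsThompsonSampling P v b r a s) (hT2 : 2 ≤ T) {V c q L : ℝ}
    (hV : ∀ t ∈ Finset.Ico 2 (T + 1), v t ≤ V) (hv : ∀ t ∈ Finset.Ico 2 (T + 1), 0 < v t)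
    (hg : 0 < g) (hκ : 0 ≤ κ) (hκg : ∀ t ∈ Finset.Ico 2 (T + 1), κ * v t ≤ g) (hq : 0 < q)
    (hc : 0 ≤ c) {ω : Ω}
    (hconf : ∀ t ∈ Finset.Ico 2 (T + 1), ω ∈ confident κ v μ b r a t)
    (h1 : ∑ t ∈ Finset.Ico 2 (T + 1), excessIncrement κ g c v μ b r a t ω ≤ L)
    (h2 : ∑ t ∈ Finset.Ico 2 (T + 1), explorationIncrement κ g q v μ b r a t ω ≤ L) :
    regret μ b a T ω ≤ 1 + √(8 * g ^ 2 * T + 8 * V ^ 2 * (c * T + L)) *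
      √(4 / q * (4 * (d * Real.log T) + L / g ^ 2) + 8 * (d * Real.log T)) := by
  set I := Finset.Ico 2 (T + 1) with hI
  have hcard : I.card ≤ T := by rw [hI, Nat.card_Ico]; omega
  have ht1 : ∀ t ∈ I, 1 ≤ t := fun t ht => by have := (Finset.mem_Ico.mp ht).1; omega
  have hX0 : ∀ t ∈ I, 0 ≤ exploration g μ b a t ω := fun t _ => unsaturatedWidthSq_nonneg
  have hV0 : 0 < V := (hv 2 (by simp [hI]; omega)).trans_le (hV 2 (by simp [hI]; omega))
  have hW : ∑ t ∈ I, width b a t (a t ω) ω ^ 2 ≤ 4 * (d * Real.log T) := by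
    have hsub : I ⊆ Finset.Icc 1 T := fun t ht => by
      simp only [hI, Finset.mem_Ico, Finset.mem_Icc] at ht ⊢; omega
    refine (Finset.sum_le_sum_of_subset_of_nonneg hsub fun _ _ _ => sq_nonneg _).trans ?_
    refine (sum_sq_width_le hB.norm_context_le T ω).trans ?_
    have h3 := log_det_designMatrix_le (a := a) hB.norm_context_le (show 1 ≤ T + 1 by omega) ω
    have h4 : Real.log ((T + 1 : ℕ) : ℝ) ≤ 2 * Real.log T := by
      have h5 : Real.log ((T : ℝ) ^ 2) = 2 * Real.log T := by rw [Real.log_pow]; norm_num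
      rw [← h5]
      refine Real.log_le_log (by positivity) ?_
      have : T + 1 ≤ T ^ 2 := by nlinarith
      exact_mod_cast this
    have h6 := mul_le_mul_of_nonneg_left h4 (Nat.cast_nonneg (α := ℝ) d)
    linarith
  have hY : ∑ t ∈ I, excess g μ b a t ω ^ 2 ≤ 4 * V ^ 2 * (c * T + L) := by
    have h3 : ∀ t ∈ I, excess g μ b a t ω ^ 2 / (4 * V ^ 2) - c ≤
        excessIncrement κ g c v μ b r a t ω := by
      intro t ht
      rw [excessIncrement, Set.indicator_of_mem (hconf t ht)]
      refine sub_le_sub_right ?_ c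
      have := hv t ht
      have := hV t ht
      gcongr
    have h4 := (Finset.sum_le_sum h3).trans h1
    rw [Finset.sum_sub_distrib, ← Finset.sum_div, Finset.sum_const, nsmul_eq_mul] at h4
    have h5 : (I.card : ℝ) * c ≤ T * c :=
      mul_le_mul_of_nonneg_right (by exact_mod_cast hcard) hc
    have h6 : (∑ t ∈ I, excess g μ b a t ω ^ 2) / (4 * V ^ 2) ≤ c * T + L := by linarith
    rw [div_le_iff₀ (by positivity)] at h6
    linarith
  have hX : ∑ t ∈ I, exploration g μ b a t ω ≤ 2 / q * (g ^ 2 * (4 * (d * Real.log T)) + L) := by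
    have h3 : ∀ t ∈ I, q / 2 * exploration g μ b a t ω - g ^ 2 * width b a t (a t ω) ω ^ 2 ≤
        explorationIncrement κ g q v μ b r a t ω := by
      intro t ht
      rw [explorationIncrement, Set.indicator_of_mem (hconf t ht)]
      have := min_le_left ((g * width b a t (a t ω) ω) ^ 2) 1
      rw [mul_pow] at this ⊢
      linarith
    have h4 := (Finset.sum_le_sum h3).trans h2
    rw [Finset.sum_sub_distrib, ← Finset.mul_sum, ← Finset.mul_sum] at h4
    have h5 := mul_le_mul_of_nonneg_left hW (sq_nonneg g)
    rw [div_mul_eq_mul_div, le_div_iff₀ hq]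
    linarith
  -- Round 1 is kept apart and charged its maximal gap 1: with unknown horizon `v 1` can be
  -- arbitrarily small when δ is near 1.
  have hsplit : regret μ b a T ω = gap μ b 1 (a 1 ω) ω + ∑ t ∈ I, gap μ b t (a t ω) ω := by
    rw [regret, ← Finset.sum_eq_sum_Ico_succ_bot (show 1 < T + 1 by omega)
      (fun t => gap μ b t (a t ω) ω)]
    rfl
  rw [hsplit]
  refine add_le_add (hB.gap_le 1 le_rfl _ ω) ?_
  have hgap : ∀ t ∈ I, gap μ b t (a t ω) ω ≤ (2 * g + excess g μ b a t ω) *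
      (√(exploration g μ b a t ω) / g + width b a t (a t ω) ω) := fun t ht =>
    gap_le_excess_mul hB.norm_param_le (hv t ht) hg hκ (hκg t ht) (hconf t ht)
      (hT.arm_argmax t (ht1 t ht) ω) (hB.gap_le t (ht1 t ht) _ ω)
  refine (Finset.sum_le_sum hgap).trans
    ((sum_mul_le_sqrt_mul_sqrt_of_bounds hcard hX0).trans ?_)
  refine mul_le_mul (Real.sqrt_le_sqrt ?_) (Real.sqrt_le_sqrt ?_) (Real.sqrt_nonneg _)
    (Real.sqrt_nonneg _)
  · linarith
  · refine add_le_add ?_ (by linarith)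
    have h3 := div_le_div_of_nonneg_right (mul_le_mul_of_nonneg_left hX zero_le_two)
      (sq_nonneg g)
    refine h3.trans_eq ?_
    field_simp
    ring

lemma sum_one_div_sq_le (T : ℕ) : ∑ t ∈ Finset.Ico 2 (T + 1), 1 / (t : ℝ) ^ 2 ≤ 1 := by
  rcases Nat.eq_zero_or_pos T with rfl | hT
  · simp
  have h : ∑ t ∈ Finset.Ico 2 (T + 1), 1 / (t : ℝ) ^ 2 ≤ 1 - 1 / (T : ℝ) := by
    induction T, hT using Nat.le_induction with
    | base => simp
    | succ T hT ih =>
      rw [Finset.sum_Ico_succ_top (by omega)]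
      have hT' : (0 : ℝ) < T := by exact_mod_cast hT
      have h1 : 1 / ((T + 1 : ℕ) : ℝ) ^ 2 ≤ 1 / (T : ℝ) - 1 / ((T + 1 : ℕ) : ℝ) := by
        push_cast
        rw [div_sub_div _ _ (by positivity) (by positivity),
          div_le_div_iff₀ (by positivity) (by positivity)]
        nlinarith
      linarith
  have : (0 : ℝ) ≤ 1 / (T : ℝ) := by positivity
  linarith

variable [IsProbabilityMeasure P]

/-- With probability at least `1 - δ` the noise and the samples behave well in all rounds. -/
lemma measure_bad_le (hR : 0 < R) (hN : 2 ≤ N) (hB : IsLinearBandit P R μ b r a)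
    (hT : IsThompsonSampling P v b r a s) {δ M q : ℝ} (hδ : 0 < δ)
    (hv : ∀ t ∈ Finset.Ico 2 (T + 1), 0 < v t)
    (hg : 0 < g) (hκ : 0 ≤ κ)
    (hMg : ∀ t ∈ Finset.Ico 2 (T + 1), (√M + κ) * v t ≤ g)
    (hM : Real.exp (3 / 2 * min (d : ℝ) (Real.log N) - M / 4) ≤ q)
    (hq : 2 * q ≤ (gaussianReal 0 1).real (Set.Ici κ)) :
    P ((⋃ t ∈ Finset.Ico 2 (T + 1), {ω | R ^ 2 * (d * Real.log t +
        2 * Real.log (1 / (δ / (3 * (t : ℝ) ^ 2)))) < selfNormSq μ b r a t ω}) ∪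
      ({ω | Real.log (1 / (δ / 3)) < ∑ t ∈ Finset.Ico 2 (T + 1),
        excessIncrement κ g (3 / 2 * min (d : ℝ) (Real.log N)) v μ b r a t ω} ∪
      {ω | Real.log (1 / (δ / 3)) < ∑ t ∈ Finset.Ico 2 (T + 1),
        explorationIncrement κ g q v μ b r a t ω})) ≤ ENNReal.ofReal δ := by
  have ht1 : ∀ t ∈ Finset.Ico 2 (T + 1), 1 ≤ t := fun t ht => by
    have := (Finset.mem_Ico.mp ht).1; omega
  have hle := fun t => hB.info_le (le_max_left 1 t)
  have hδ3 : 0 < δ / 3 := by positivity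
  have e1 := measure_exp_sum_gt_le (P := P) (info_mono (b := b) (r := r) (a := a)) hle
    (ξ := excessIncrement κ g (3 / 2 * min (d : ℝ) (Real.log N)) v μ b r a) (s := 2) (T := T + 1)
    (fun t ht => by
      rw [max_eq_right (by omega)]
      exact measurable_excessIncrement (ht1 t ht) _)
    (fun t ht => by
      simp only [max_eq_right (ht1 t ht)]
      refine condMeanLEOne_exp_excessIncrement hN hB hT (ht1 t ht) (hv t ht) hg hκ
        (le_trans ?_ (hMg t ht))
      have := hv t ht
      gcongr
      linarith [Real.sqrt_nonneg M]) hδ3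
  have e2 := measure_exp_sum_gt_le (P := P) (info_mono (b := b) (r := r) (a := a)) hle
    (ξ := explorationIncrement κ g q v μ b r a) (s := 2) (T := T + 1)
    (fun t ht => by
      rw [max_eq_right (by omega)]
      exact measurable_explorationIncrement (ht1 t ht) _)
    (fun t ht => by
      simp only [max_eq_right (ht1 t ht)]
      exact condMeanLEOne_exp_explorationIncrement hN hB hT (ht1 t ht) (hv t ht) (hMg t ht)
        hM hq) hδ3
  -- A union bound over rounds at levels δ/(3t²), whose sum from t = 2 on is at most δ/3.
  have e0 : P (⋃ t ∈ Finset.Ico 2 (T + 1), {ω | R ^ 2 * (d * Real.log t +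
        2 * Real.log (1 / (δ / (3 * (t : ℝ) ^ 2)))) < selfNormSq μ b r a t ω}) ≤
      ENNReal.ofReal (δ / 3) := by
    refine (measure_biUnion_finset_le _ _).trans ?_
    have h1 : ∀ t ∈ Finset.Ico 2 (T + 1), P {ω | R ^ 2 * (d * Real.log t +
        2 * Real.log (1 / (δ / (3 * (t : ℝ) ^ 2)))) < selfNormSq μ b r a t ω} ≤
        ENNReal.ofReal (δ / (3 * (t : ℝ) ^ 2)) := fun t ht => by
      have : (0 : ℝ) < t := by exact_mod_cast (ht1 t ht)
      exact measure_selfNormSq_gt_le hR hB hT (ht1 t ht) (by positivity)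
    refine (Finset.sum_le_sum h1).trans ?_
    rw [← ENNReal.ofReal_sum_of_nonneg fun t _ => by positivity]
    refine ENNReal.ofReal_le_ofReal ?_
    have h2 : ∀ t : ℕ, δ / (3 * (t : ℝ) ^ 2) = δ / 3 * (1 / (t : ℝ) ^ 2) := fun t => by
      rw [div_mul_div_comm, mul_one]
    simp only [h2]
    rw [← Finset.mul_sum]
    exact mul_le_of_le_one_right hδ3.le (sum_one_div_sq_le T)
  refine (measure_union_le _ _).trans ((add_le_add e0 ((measure_union_le _ _).trans
    (add_le_add e1 e2))).trans_eq ?_)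
  rw [← ENNReal.ofReal_add hδ3.le hδ3.le, ← ENNReal.ofReal_add hδ3.le (by positivity)]
  congr 1
  ring

end Regret

/-! ### Simplifying the bound -/

section FinalBound

lemma regret_bound_le {R K q δ : ℝ} (hR : 0 < R) (hK : 2 ≤ K) (hq : 0 < q) {d N T : ℕ}
    (hd : 1 ≤ d) (hN : 2 ≤ N) (hT : 2 ≤ T) (hδ : 0 < δ) (hδ1 : δ < 1)
    (hδT : Real.log (1 / δ) ≤ T) {g L : ℝ}
    (hg : g = K * √(min (d : ℝ) (Real.log N)) * scale R d δ T)
    (hL : L = Real.log (1 / (δ / 3))) :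
    1 + √(8 * g ^ 2 * T + 8 * scale R d δ T ^ 2 *
        (3 / 2 * min (d : ℝ) (Real.log N) * T + L)) *
      √(4 / q * (4 * (d * Real.log T) + L / g ^ 2) + 8 * (d * Real.log T)) ≤
      (4 + 3 * R * √((8 * K ^ 2 + 44) * (4 / q * (4 + 2 / R ^ 2) + 8))) *
        min (dimBound d T δ) (armBound d N T δ) := by
  have hd' : (1 : ℝ) ≤ d := by exact_mod_cast hd
  have hT' : (2 : ℝ) ≤ T := by exact_mod_cast hT
  have hlT := half_le_log hT'
  have hl := log_one_div_nonneg hδ hδ1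
  have hm := half_le_min_dim_log hd hN
  have hlogTδ := log_div_delta (show (0 : ℝ) < T by linarith) hδ
  set m := min (d : ℝ) (Real.log N) with hm_def
  set V := scale R d δ T with hV_def
  set lT := Real.log (T : ℝ)
  set lδ := Real.log (1 / δ)
  have hL' : L = Real.log 3 + lδ := by
    rw [hL, one_div_div, log_div_delta (by norm_num) hδ]
  have h3a : Real.log 3 ≤ 2 := by
    have := Real.log_le_sub_one_of_pos (show (0 : ℝ) < 3 by norm_num)
    linarith
  have h3b : Real.log 3 ≤ 2 * lT := log_three_le_two_mul_log hT'
  have h3c : 0 ≤ Real.log 3 := Real.log_nonneg (by norm_num)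
  -- Here ln(1/δ) ≤ T enters: L ≤ 2 + T ≤ 2T ≤ 4mT.
  have hL1 : L ≤ 4 * m * T := by nlinarith
  have hL2 : L ≤ 2 * (lT + lδ) := by linarith
  have hV2 : V ^ 2 = 9 * R ^ 2 * d * (lT + lδ) := by
    rw [hV_def, scale, mul_pow, Real.sq_sqrt, hlogTδ]
    · ring
    · rw [hlogTδ]; positivity
  have hV0 : 0 ≤ V := by rw [hV_def, scale]; positivity
  have hm0 : 0 ≤ m := by linarith
  have hg2 : g ^ 2 = K ^ 2 * m * V ^ 2 := by
    rw [hg, mul_pow, mul_pow, Real.sq_sqrt hm0]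
  have hsum : 0 < lT + lδ := by linarith
  -- Both L and g² scale with ln T + ln(1/δ), so the dependence on δ cancels.
  have hLg : L / g ^ 2 ≤ 2 / R ^ 2 * (d * lT) := by
    have h1 : 18 * R ^ 2 * (lT + lδ) ≤ g ^ 2 := by
      rw [hg2, hV2]
      have h4 : (2 : ℝ) ≤ K ^ 2 * m := by nlinarith
      have h5 : 9 * R ^ 2 * (lT + lδ) ≤ 9 * R ^ 2 * d * (lT + lδ) := by
        have : 0 ≤ 9 * R ^ 2 * (lT + lδ) := by positivity
        nlinarith
      have h6 : 0 ≤ 9 * R ^ 2 * (lT + lδ) := by positivity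
      nlinarith
    have h2 : L / g ^ 2 ≤ 2 * (lT + lδ) / (18 * R ^ 2 * (lT + lδ)) := by
      gcongr
    have h4 : 2 * (lT + lδ) / (18 * R ^ 2 * (lT + lδ)) = 1 / 9 * (1 / R ^ 2) := by
      field_simp
      norm_num
    have h5 : 2 / R ^ 2 * (d * lT) = (2 * (d * lT)) * (1 / R ^ 2) := by ring
    rw [h4] at h2
    rw [h5]
    refine h2.trans (mul_le_mul_of_nonneg_right ?_ (by positivity))
    nlinarith
  have hA : 8 * g ^ 2 * T + 8 * V ^ 2 * (3 / 2 * m * T + L) ≤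
      (8 * K ^ 2 + 44) * (m * V ^ 2 * T) := by
    rw [hg2]
    have : V ^ 2 * L ≤ V ^ 2 * (4 * m * T) := mul_le_mul_of_nonneg_left hL1 (sq_nonneg V)
    linarith
  have hBd : 4 / q * (4 * (d * lT) + L / g ^ 2) + 8 * (d * lT) ≤
      (4 / q * (4 + 2 / R ^ 2) + 8) * (d * lT) := by
    have : 4 / q * (L / g ^ 2) ≤ 4 / q * (2 / R ^ 2 * (d * lT)) :=
      mul_le_mul_of_nonneg_left hLg (by positivity)
    linarith
  set C₁ := 8 * K ^ 2 + 44
  set C₂ := 4 / q * (4 + 2 / R ^ 2) + 8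
  have hC : 0 ≤ C₁ * C₂ := by positivity
  have hprod : √(8 * g ^ 2 * T + 8 * V ^ 2 * (3 / 2 * m * T + L)) *
      √(4 / q * (4 * (d * lT) + L / g ^ 2) + 8 * (d * lT)) ≤
      3 * R * √(C₁ * C₂) * (d * √m * √T * √(lT * (lT + lδ))) := by
    calc _ ≤ √(C₁ * (m * V ^ 2 * T)) * √(C₂ * (d * lT)) := by gcongr
      _ = √((C₁ * C₂) * ((3 * R * d) ^ 2 * (m * (T * (lT * (lT + lδ)))))) := by
          rw [← Real.sqrt_mul (by positivity), hV2]
          congr 1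
          ring
      _ = _ := by
          rw [Real.sqrt_mul hC, Real.sqrt_mul (sq_nonneg _), Real.sqrt_sq (by positivity),
            Real.sqrt_mul hm0,
            Real.sqrt_mul (show (0 : ℝ) ≤ T by positivity) (lT * (lT + lδ))]
          ring
  -- Absorbs the cost of round 1.
  have hone : 1 ≤ 4 * min (dimBound d T δ) (armBound d N T δ) := by
    have h1 := sqrt_mul_le_two_mul_bound (T := T) hd hN (δ := δ) (y := 1 / 2)
      (le_trans hlT (le_add_of_nonneg_right (Real.sqrt_nonneg _)))
    have h2 : 1 ≤ √(T : ℝ) := Real.one_le_sqrt.mpr (by linarith)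
    linarith
  have hmain : d * √m * √T * √(lT * (lT + lδ)) ≤ min (dimBound d T δ) (armBound d N T δ) := by
    rw [min_dimBound_armBound]
    have h1 := sqrt_log_mul_log_div_le hT' hδ hδ1
    rw [hlogTδ] at h1
    exact mul_le_mul_of_nonneg_left h1 (by positivity)
  have h4 : 3 * R * √(C₁ * C₂) * (d * √m * √T * √(lT * (lT + lδ))) ≤
      3 * R * √(C₁ * C₂) * min (dimBound d T δ) (armBound d N T δ) :=
    mul_le_mul_of_nonneg_left hmain (by positivity)
  linarith

/-- For very small δ the factor √(ln T ln(1/δ)) is at least √T / 2, so the bound exceeds the trivial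
regret T up to a constant. -/
lemma horizon_le_bound {d N T : ℕ} (hd : 1 ≤ d) (hN : 2 ≤ N) (hT : 2 ≤ T) {δ : ℝ}
    (hδT : (T : ℝ) < Real.log (1 / δ)) :
    (T : ℝ) ≤ 4 * min (dimBound d T δ) (armBound d N T δ) := by
  have hT' : (2 : ℝ) ≤ T := by exact_mod_cast hT
  have hlT := half_le_log hT'
  have h1 : √(T : ℝ) / 2 ≤ √(Real.log T * Real.log (1 / δ)) := by
    refine Real.le_sqrt_of_sq_le ?_
    rw [div_pow, Real.sq_sqrt (by positivity)]
    nlinarith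
  have h2 := sqrt_mul_le_two_mul_bound (T := T) hd hN (δ := δ) (y := √(T : ℝ) / 2)
    (le_trans h1 (le_add_of_nonneg_left (by linarith)))
  have h3 := Real.mul_self_sqrt (show (0 : ℝ) ≤ T by positivity)
  linarith

lemma min_bound_nonneg (d N T : ℕ) (δ : ℝ) : 0 ≤ min (dimBound d T δ) (armBound d N T δ) := by
  rw [min_dimBound_armBound]
  have := Real.log_natCast_nonneg T
  positivity

lemma one_sub_le_measureReal {Ω : Type*} [MeasurableSpace Ω] {P : Measure Ω}
    [IsProbabilityMeasure P] {S B : Set Ω} {δ : ℝ} (hδ : 0 ≤ δ) (hB : P B ≤ ENNReal.ofReal δ)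
    (h : ∀ ω, ω ∉ B → ω ∈ S) : 1 - δ ≤ P.real S := by
  have h1 : P.real Set.univ ≤ P.real S + P.real B :=
    (measureReal_mono fun ω _ => by
      by_cases hω : ω ∈ B
      · exact Or.inr hω
      · exact Or.inl (h ω hω)).trans (measureReal_union_le S B)
  have h2 : P.real B ≤ δ := ENNReal.toReal_le_of_le_ofReal hδ hB
  rw [probReal_univ] at h1
  linarith

end FinalBound

end LinBandit

end

/-! ### Choice of constants and conclusion -/

theorem theorem1 (R : ℝ) (hR : 0 < R) :
    ∃ C : ℝ, 0 < C ∧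
      ∀ (d N T : ℕ) (_ : 2 ≤ T) (δ : ℝ) (_ : 0 < δ) (_ : δ < 1)
        (v : ℕ → ℝ)
        (_ : (∀ t : ℕ, 1 ≤ t → v t = LinBandit.scale R d δ t) ∨
          (∀ t : ℕ, 1 ≤ t → v t = LinBandit.scale R d δ T))
        (Ω : Type*) [MeasurableSpace Ω] (P : Measure Ω) [IsProbabilityMeasure P]
        (μ : LinBandit.Vec d) (b : ℕ → Fin N → Ω → LinBandit.Vec d)
        (r : ℕ → Fin N → Ω → ℝ) (a : ℕ → Ω → Fin N) (s : ℕ → Ω → LinBandit.Vec d)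
        (_ : LinBandit.IsLinearBandit P R μ b r a)
        (_ : LinBandit.IsThompsonSampling P v b r a s),
        1 - δ ≤ P.real {ω | LinBandit.regret μ b a T ω ≤
          C * min (LinBandit.dimBound d T δ) (LinBandit.armBound d N T δ)} := by
  -- The noise contributes at most v_t to the confidence radius, and the bias 1 is at most v_t /
  -- (2R) because v_t ≥ 2R from round 2 on.
  set κ : ℝ := 1 + 1 / (2 * R) with hκ_def
  have hκ1 : 1 ≤ κ := le_add_of_nonneg_right (by positivity)
  set q : ℝ := (gaussianReal 0 1).real (Set.Ici κ) / 2 with hq_def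
  have hq0 : 0 < q := half_pos (LinBandit.gaussianReal_Ici_pos κ)
  have hq1 : q ≤ 1 := by
    have : (gaussianReal 0 1).real (Set.Ici κ) ≤ 1 := measureReal_le_one
    linarith
  have hlq : 0 ≤ Real.log (1 / q) := Real.log_nonneg (by rw [le_div_iff₀ hq0]; linarith)
  -- With M = K₀ m the tail exponent 3m/2 - M/4 equals -2m ln(1/q), at most ln q since m ≥ 1/2.
  set K₀ : ℝ := 6 + 8 * Real.log (1 / q) with hK₀
  -- The factor 2 absorbs κ into 2κ√m, as √m ≥ 1/2.
  set K : ℝ := √K₀ + 2 * κ with hK_def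
  have hK2 : 2 ≤ K := by linarith [Real.sqrt_nonneg K₀]
  set C : ℝ := 4 + 3 * R * √((8 * K ^ 2 + 44) * (4 / q * (4 + 2 / R ^ 2) + 8)) with hC
  have hC4 : 4 ≤ C := le_add_of_nonneg_right (by positivity)
  refine ⟨C, by linarith, ?_⟩
  intro d N T hT2 δ hδ hδ1 v hv Ω _ P _ μ b r a s hB hTS
  have hbnd := LinBandit.min_bound_nonneg d N T δ
  have hall : (∀ ω, LinBandit.regret μ b a T ω ≤
      C * min (LinBandit.dimBound d T δ) (LinBandit.armBound d N T δ)) →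
      1 - δ ≤ P.real {ω | LinBandit.regret μ b a T ω ≤
        C * min (LinBandit.dimBound d T δ) (LinBandit.armBound d N T δ)} := fun h =>
    LinBandit.one_sub_le_measureReal (B := ∅) hδ.le (by simp) fun ω _ => h ω
  -- The degenerate cases d = 0 and N ≤ 1 have zero regret; they are removed because the estimates
  -- need m ≥ 1/2.
  rcases Nat.eq_zero_or_pos d with rfl | hd
  · refine hall fun ω => ?_
    rw [LinBandit.regret_eq_zero_of_forall_inner_eq fun t i j ω => by
      simp [Subsingleton.elim μ 0]]
    exact mul_nonneg (by linarith) hbnd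
  rcases Nat.lt_or_ge N 2 with hN | hN
  · refine hall fun ω => ?_
    have : Subsingleton (Fin N) := Fin.subsingleton_iff_le_one.mpr (by omega)
    rw [LinBandit.regret_eq_zero_of_forall_inner_eq fun t i j ω => by
      rw [Subsingleton.elim i j]]
    exact mul_nonneg (by linarith) hbnd
  rcases lt_or_ge (T : ℝ) (Real.log (1 / δ)) with hδT | hδT
  · refine hall fun ω => (LinBandit.regret_le_horizon hB T ω).trans
      ((LinBandit.horizon_le_bound hd hN hT2 hδT).trans ?_)
    exact mul_le_mul_of_nonneg_right hC4 hbnd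
  have : NeZero N := ⟨by omega⟩
  have hm := LinBandit.half_le_min_dim_log hd hN
  set m := min (d : ℝ) (Real.log N) with hm_def
  have hsm : 1 / 2 ≤ √m := Real.le_sqrt_of_sq_le (le_trans (by norm_num) hm)
  set V := LinBandit.scale R d δ T with hV_def
  set I := Finset.Ico 2 (T + 1) with hI
  have hcast : ∀ t ∈ I, (2 : ℝ) ≤ t ∧ (t : ℝ) ≤ T := fun t ht => by
    have h := Finset.mem_Ico.mp ht
    exact ⟨by exact_mod_cast h.1, by exact_mod_cast (by omega : t ≤ T)⟩
  have hscale : ∀ t ∈ I, LinBandit.scale R d δ t ≤ v t ∧ v t ≤ V := by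
    intro t ht
    have h2 := hcast t ht
    have hmono := LinBandit.scale_mono hR d hδ (by linarith : (0 : ℝ) < t) h2.2
    have h1 : 1 ≤ t := by have := (Finset.mem_Ico.mp ht).1; omega
    rcases hv with hv | hv
    · rw [hv t h1]; exact ⟨le_rfl, hmono⟩
    · rw [hv t h1]; exact ⟨hmono, le_rfl⟩
  have hv2 : ∀ t ∈ I, 2 * R ≤ v t := fun t ht =>
    (LinBandit.two_mul_le_scale hR hd hδ hδ1 (hcast t ht).1).trans (hscale t ht).1
  have hvpos : ∀ t ∈ I, 0 < v t := fun t ht => by linarith [hv2 t ht]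
  have hV0 : 0 < V := by
    have h2 : 2 ∈ I := by simp [hI]; omega
    exact (hvpos 2 h2).trans_le (hscale 2 h2).2
  set g := K * √m * V with hg_def
  have hg : 0 < g := by positivity
  have hMg : ∀ t ∈ I, (√(K₀ * m) + κ) * v t ≤ g := by
    intro t ht
    have h1 : √(K₀ * m) + κ ≤ K * √m := by
      rw [Real.sqrt_mul (by positivity), hK_def]
      nlinarith
    exact mul_le_mul h1 (hscale t ht).2 (hvpos t ht).le (by positivity)
  have hκg : ∀ t ∈ I, κ * v t ≤ g := fun t ht => by
    refine le_trans (mul_le_mul_of_nonneg_right ?_ (hvpos t ht).le) (hMg t ht)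
    linarith [Real.sqrt_nonneg (K₀ * m)]
  have hM : Real.exp (3 / 2 * m - K₀ * m / 4) ≤ q := by
    rw [← Real.le_log_iff_exp_le hq0]
    have : Real.log (1 / q) = -Real.log q := by rw [one_div, Real.log_inv]
    nlinarith
  refine LinBandit.one_sub_le_measureReal hδ.le (LinBandit.measure_bad_le (T := T) hR hN hB hTS hδ
    hvpos hg (by linarith) hMg hM (by linarith)) fun ω hω => ?_
  simp only [Set.mem_union, not_or] at hω
  obtain ⟨hω0, hω1, hω2⟩ := hω
  have hconf : ∀ t ∈ I, ω ∈ LinBandit.confident κ v μ b r a t := by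
    intro t ht
    have h1 : LinBandit.selfNormSq μ b r a t ω ≤ R ^ 2 * (d * Real.log t +
        2 * Real.log (1 / (δ / (3 * (t : ℝ) ^ 2)))) := by
      by_contra hcon
      exact hω0 (Set.mem_biUnion ht (not_le.mp hcon))
    have h2 := (LinBandit.sqrt_le_scale hR hd hδ hδ1 (hcast t ht).1 h1).trans (hscale t ht).1
    have h3 : 1 ≤ 1 / (2 * R) * v t := by
      rw [one_div_mul_eq_div, le_div_iff₀ (by positivity), one_mul]
      exact hv2 t ht
    change √(LinBandit.selfNormSq μ b r a t ω) + 1 ≤ κ * v t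
    rw [hκ_def, add_mul, one_mul]
    linarith
  exact (LinBandit.regret_le_of_good hB hTS hT2 (fun t ht => (hscale t ht).2) hvpos hg
    (by linarith) hκg hq0 (by positivity) hconf (not_lt.mp hω1) (not_lt.mp hω2)).trans
    (LinBandit.regret_bound_le hR hK2 hq0 hd hN hT2 hδ hδ1 hδT hg_def rfl)
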